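/- **Residue Theorem.** Let $p$ be an odd prime, let $\mathbb{C}_p$ be the completion of an algebraic closure of $\mathbb{Q}_p$ with $|p|_p = 1/p$, and write $D^{+}(c,s)=\{x\in\mathbb{C}_p : |x-c|_p\le s\}$ and $D^{-}(c,s)=\{x\in\mathbb{C}_p : |x-c|_p< s\}$. *Definitions.* - *Arc integral.* For $|b-a|_p=R>0$ let $\mathcal{A}(a,b)=D^{-}(b,R)$. For $f\colon\mathcal{A}(a,b)\to\mathbb{C}_p$ and an integer $n\ge 1$ put $A_f(n)=p^{-n}\sum_{x}(x-a)f(x)$, where $x=a+(b-a)\zeta$ and $\zeta$ runs through the $p^{n}$-th roots of unity. For an integer $\alpha\ge 0$ let $\Phi_\alpha$ be the family of the sequences $\varphi(k)=\alpha+\lambda k$, $\lambda=1,2,\dots$. The equation $\int_{\mathcal{A}(a,b),\Phi_\alpha}f(x)\,dx=L$ means that for every $\varepsilon>0$ there are $\varphi\in\Phi_\alpha$ and $K$ such that $|A_f(\varphi(k))-L|_p<\varepsilon$ for all $k>K$; such an $L$ is unique if it exists. - *Krasner analytic.* A function on $\mathcal{D}\subseteq\mathbb{C}_p$ is Krasner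 analytic on $\mathcal{D}$ if it is the uniform limit on $\mathcal{D}$ of rational functions whose poles lie outside $\mathcal{D}$. - *Teichmüller character.* If $|x|_p=1$, then $\omega(x)$ is the unique root of unity of order prime to $p$ with $|x-\omega(x)|_p<1$; if $|x|_p<1$, then $\omega(x)=0$. Moreover $\omega^{p^\alpha}(x)=\omega(x)^{p^\alpha}$. - *Residue.* If $f$ has a Laurent expansion $f(x)=\sum_{n\in\mathbb{Z}}c_n(x-x_i)^n$ on an annulus $r_i\le|x-x_i|_p<\rho$ around the hole $D^{-}(x_i,r_i)$, for some $\rho>r_i$, then $\operatorname{Res}_{x=x_i}f(x)=c_{-1}$. *Theorem.* Let $M\ge 0$, let $$\mathcal{D}=D^{+}(a,R)\setminus\bigcup_{i=1}^{M}D^{-}(x_i,r_i),\qquad 0<r_i<R,$$ where the closed discs $D^{+}(x_i,r_i)$ are mutually disjoint, and let $b\in\mathbb{C}_p$ satisfy $|b-a|_p=|b-x_i|_p=R$ for all $i$ (the $x_i$ may lie on the circle $|x-a|_p=R$). Let $\alpha\ge 0$ be an integer and let $f$ be Krasner analytic on $\mathcal{D}$. Then for every $i$ the residue $\operatorname{Res}_{x=x_i}f(x)$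 exists and is uniquely determined, $1-\omega^{p^\alpha}\!\left(\frac{a-x_i}{a-b}\right)\ne 0$, the integral of $f$ over $\mathcal{A}(a,b)$ with respect to $\Phi_\alpha$ exists, and $$\int_{\mathcal{A}(a,b),\Phi_\alpha}f(x)\,dx=\sum_{i=1}^{M}\frac{1}{1-\omega^{p^\alpha}\!\left(\frac{a-x_i}{a-b}\right)}\,\operatorname*{Res}_{x=x_i}f(x).$$ -/

import Mathlib

namespace PadicLineIntegral

open Filter

variable {p : ℕ} [Fact p.Prime]

/-- A path sequence: a function `φ` with positive integer values that is strictly increasing for all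
`k ≥ k₀`, for some `k₀`. The values at `k < k₀` play no role. -/
def IsPathSequence (φ : ℕ → ℕ) : Prop :=
  ∃ k₀ : ℕ, (∀ k, k₀ ≤ k → 0 < φ k) ∧ StrictMonoOn φ (Set.Ici k₀)

/-- For all sufficiently large `k`, `ψ k` is a subsequence of `φ`. -/
def IsEventuallySubsequence (ψ φ : ℕ → ℕ) : Prop :=
  ∃ k₀ : ℕ, ∃ s : ℕ → ℕ, StrictMonoOn s (Set.Ici k₀) ∧ ∀ k, k₀ ≤ k → ψ k = φ (s k)

/-- An interlocked family of path sequences: a non-empty family such that any two members have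
eventually a common subsequence in the family. -/
structure InterlockedFamily where
  carrier : Set (ℕ → ℕ)
  isPathSequence : ∀ φ ∈ carrier, IsPathSequence φ
  nonempty : carrier.Nonempty
  interlocked : ∀ φ₁ ∈ carrier, ∀ φ₂ ∈ carrier, ∃ φ₃ ∈ carrier,
    IsEventuallySubsequence φ₃ φ₁ ∧ IsEventuallySubsequence φ₃ φ₂

/-- The family `Φ_α` of all the path sequences `k ↦ α + l * k`, `l = 1, 2, …`. -/
def Phi (α : ℕ) : InterlockedFamily where
  carrier := {φ | ∃ l : ℕ, 0 < l ∧ φ = fun k => α + l * k}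
  isPathSequence := by
    rintro φ ⟨l, hl, rfl⟩
    refine ⟨1, fun k hk => ?_, fun i _ j _ hij => ?_⟩
    · have : 0 < l * k := Nat.mul_pos hl hk
      show 0 < α + l * k
      omega
    · exact Nat.add_lt_add_left (Nat.mul_lt_mul_of_pos_left hij hl) α
  nonempty := ⟨_, 1, one_pos, rfl⟩
  interlocked := by
    rintro φ₁ ⟨l, hl, rfl⟩ φ₂ ⟨m, hm, rfl⟩
    refine ⟨_, ⟨l * m, Nat.mul_pos hl hm, rfl⟩,
      ⟨0, fun k => m * k, fun i _ j _ hij => Nat.mul_lt_mul_of_pos_left hij hm, fun k _ => ?_⟩,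
      ⟨0, fun k => l * k, fun i _ j _ hij => Nat.mul_lt_mul_of_pos_left hij hl, fun k _ => ?_⟩⟩
    · simp only [mul_assoc]
    · simp only [mul_left_comm m, mul_assoc]

/-- The sum `p ^ (-n) * ∑ₓ (x - a) * f x` over the points `x = a + (b - a) * ζ`, where `ζ` runs
through the `p ^ n`-th roots of unity in `ℂ_[p]`. These points lie on the arc
`{x | ‖x - b‖ < ‖b - a‖}`, so only the values of `f` on the arc matter. -/
noncomputable def arcSum (f : ℂ_[p] → ℂ_[p]) (a b : ℂ_[p]) (n : ℕ) : ℂ_[p] :=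
  ((p : ℂ_[p]) ^ n)⁻¹ * ∑ ζ ∈ Polynomial.nthRootsFinset (p ^ n) (1 : ℂ_[p]),
    ((a + (b - a) * ζ) - a) * f (a + (b - a) * ζ)

/-- The line integral of `f` on the arc `𝒜(a, b)` with respect to the family `Φ` exists and
equals `L`. -/
def HasArcIntegral (f : ℂ_[p] → ℂ_[p]) (a b : ℂ_[p]) (Φ : InterlockedFamily) (L : ℂ_[p]) : Prop :=
  ∀ ε : ℝ, 0 < ε → ∃ φ ∈ Φ.carrier, ∃ K : ℕ, ∀ k, K < k → ‖arcSum f a b (φ k) - L‖ < ε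

/-- `w` is a root of unity of order prime to `p` with `‖x - w‖ < 1`. -/
def IsTeichmullerRep (x w : ℂ_[p]) : Prop :=
  (∃ n : ℕ, 0 < n ∧ n.Coprime p ∧ w ^ n = 1) ∧ ‖x - w‖ < 1

open Classical in
/-- The Teichmüller character `ω` on the closed unit disc of `ℂ_[p]`: for `‖x‖ = 1`, `ω x` is the
unique root of unity of order prime to `p` with `‖x - ω x‖ < 1`; for `‖x‖ < 1`, `ω x = 0`
(also used, as an irrelevant value, outside the closed unit disc). -/
noncomputable def teichmuller (x : ℂ_[p]) : ℂ_[p] :=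
  if ‖x‖ = 1 then Classical.epsilon (IsTeichmullerRep x) else 0

/-- `f` is Krasner analytic on `D`: it is the uniform limit on `D` of rational functions without
poles in `D`. -/
def IsKrasnerAnalyticOn (f : ℂ_[p] → ℂ_[p]) (D : Set ℂ_[p]) : Prop :=
  ∃ P Q : ℕ → Polynomial ℂ_[p], (∀ n, ∀ x ∈ D, (Q n).eval x ≠ 0) ∧
    TendstoUniformlyOn (fun n x => (P n).eval x / (Q n).eval x) f atTop D

/-- `c` is the residue of `f` at the centre `x₀` of a hole `{x | ‖x - x₀‖ < r}` of its domain: the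
coefficient of `(x - x₀)⁻¹` in a Laurent expansion `f x = ∑ cₙ (x - x₀) ^ n` that is valid on an
annulus `r ≤ ‖x - x₀‖ < ρ` around the hole. -/
def HasResidueAt (f : ℂ_[p] → ℂ_[p]) (x₀ : ℂ_[p]) (r : ℝ) (c : ℂ_[p]) : Prop :=
  ∃ ρ : ℝ, r < ρ ∧ ∃ u : ℤ → ℂ_[p], u (-1) = c ∧
    ∀ x : ℂ_[p], r ≤ ‖x - x₀‖ → ‖x - x₀‖ < ρ → HasSum (fun n : ℤ => u n * (x - x₀) ^ n) (f x)

/-- The residue of `f` at the centre `x₀` of a hole of radius `r` (meaningful when there is exactly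
one `c` with `HasResidueAt f x₀ r c`). -/
noncomputable def residueAt (f : ℂ_[p] → ℂ_[p]) (x₀ : ℂ_[p]) (r : ℝ) : ℂ_[p] :=
  Classical.epsilon (HasResidueAt f x₀ r)

/-- The closed disc with centre `a` and radius `R` without the open discs with centres `x i` and
radii `r i`. -/
def discWithHoles {M : ℕ} (a : ℂ_[p]) (R : ℝ) (x : Fin M → ℂ_[p]) (r : Fin M → ℝ) : Set ℂ_[p] :=
  Metric.closedBall a R \ ⋃ i, Metric.ball (x i) (r i)

end PadicLineIntegral

/-!
The function `f` has a Mittag-Leffler expansion on the disc with holes: it is the uniformly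
convergent sum of a power series in `z - b` and, for each hole, of a power series without constant
term in `(z - x i)⁻¹`. For a rational function this results from the partial fraction decomposition
(`exists_isMittagLeffler_eval_div_eval`). A Mittag-Leffler expansion turns into a Laurent expansion
around each hole (`IsMittagLeffler.exists_laurent`), so that Cauchy's estimate for Laurent series
(`norm_coeff_mul_zpow_le`) bounds the coefficients by the supremum norm of the function
(`IsMittagLeffler.norm_mul_le`). Hence the coefficients converge when the functions converge
uniformly, and the expansion exists for Krasner analytic functions
(`exists_isMittagLeffler_of_tendstoUniformly`). The residue at `x i` is the coefficient of
`(z - x i)⁻¹`; it is unique by Cauchy's estimate.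

The arc sum is a mean over the `p ^ n`-th roots of unity, and it is computed term by term. With
`u = (a - x i) / (a - b)`, one has `‖u‖ ≤ 1` and `‖1 - u‖ = 1`. The powers of `z - b` contribute
zero for large `n`. The term `(z - x i)⁻¹` contributes `1 / (1 - u ^ p ^ n)`, and the contributions
of the higher negative powers are given by a recursion (`poleMean_eq`) whose coefficients
`(p ^ n).choose j`, `0 < j`, tend to zero. All these contributions are bounded by `R` times the
weights of the terms (`mlWeight`), so that the limit may be taken term by term
(`IsMittagLeffler.tendsto_rootMean`).

Finally `u ^ p ^ n - ω(u) ^ p ^ n` tends to zero, and some power `p ^ l` fixes all the finitely many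
values `ω(u)` (`teichmuller_spec`). Hence `u ^ p ^ n` tends to `ω(u) ^ p ^ α` along
`n = α + l * k`, which is a sequence of the family `Φ_α`. The existence of `ω(u)` rests on the
density of the elements algebraic over `ℚ_[p]`, each of which generates an extension with finite
residue field (`exists_norm_pow_sub_one_lt_one_of_algebraic`).
-/

namespace PadicLineIntegral

open Filter Topology

/-! ### Sums of null families in a nonarchimedean field -/

section Sums

variable {K : Type*} [NormedField K] [IsUltrametricDist K]

theorem norm_sub_le_max (s t : K) : ‖s - t‖ ≤ max ‖s‖ ‖t‖ := by
  rw [sub_eq_add_neg, ← norm_neg t]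
  exact IsUltrametricDist.norm_add_le_max s (-t)

theorem norm_le_of_hasSum {ι : Type*} {f : ι → K} {s : K} {C : ℝ} (hC : 0 ≤ C)
    (hf : HasSum f s) (h : ∀ i, ‖f i‖ ≤ C) : ‖s‖ ≤ C :=
  hf.tsum_eq ▸ IsUltrametricDist.norm_tsum_le_of_forall_le_of_nonneg hC h

/-- Fubini for a family over `ι × κ` whose rows are summable and bounded by a null family. -/
theorem hasSum_tsum_comm [CompleteSpace K] {ι κ : Type*} {G : ι → κ → K} {B : ι → ℝ} {g : ι → K}
    {S : K} (hB : Tendsto B cofinite (𝓝 0)) (hG : ∀ j n, ‖G j n‖ ≤ B j)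
    (hg : ∀ j, HasSum (G j) (g j)) (hS : HasSum g S) :
    HasSum (fun n => ∑' j, G j n) S := by
  have h0 : Tendsto (fun q : ι × κ => G q.1 q.2) cofinite (𝓝 0) := by
    rw [Metric.tendsto_nhds]
    intro ε hε
    have h1 : {j | ¬ B j < ε}.Finite := (hB.eventually (gt_mem_nhds hε) : ∀ᶠ j in cofinite, B j < ε)
    have h2 : ∀ j, {n | ¬ ‖G j n‖ < ε}.Finite := fun j => by
      have := (hg j).summable.tendsto_cofinite_zero
      rw [Metric.tendsto_nhds] at this
      simpa using this ε hε
    refine Set.Finite.subset (h1.biUnion fun j _ => (Set.finite_singleton j).prod (h2 j)) ?_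
    rintro ⟨j, n⟩ hjn
    have hjn : ¬ ‖G j n‖ < ε := by simpa using hjn
    simp only [Set.mem_iUnion]
    exact ⟨j, fun h => hjn ((hG j n).trans_lt h), rfl, hjn⟩
  have hs := NonarchimedeanAddGroup.summable_of_tendsto_cofinite_zero h0
  have e : ∑' q : ι × κ, G q.1 q.2 = S :=
    (hs.hasSum.prod_fiberwise hg).unique hS
  have hs' : HasSum (fun q : κ × ι => G q.2 q.1) S := by
    have := (Equiv.prodComm κ ι).hasSum_iff (f := fun q : ι × κ => G q.1 q.2) (a := S)
    exact this.mpr (e ▸ hs.hasSum)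
  refine hs'.prod_fiberwise fun n => ?_
  exact (hs'.summable.prod_factor n).hasSum

/-- Passage to the limit under a sum whose terms are bounded by a null family. -/
theorem tendsto_of_hasSum_of_le {ι : Type*} {F : ι → ℕ → K} {B : ι → ℝ} {S : ℕ → K}
    {l : ι → K} {s : K} (hB : Tendsto B cofinite (𝓝 0)) (hF : ∀ j k, ‖F j k‖ ≤ B j)
    (hS : ∀ k, HasSum (fun j => F j k) (S k)) (hl : ∀ j, Tendsto (F j) atTop (𝓝 (l j)))
    (hs : HasSum l s) : Tendsto S atTop (𝓝 s) := by
  rw [Metric.tendsto_atTop]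
  intro ε hε
  have h1 : {j | ¬ B j < ε / 2}.Finite :=
    (hB.eventually (gt_mem_nhds (half_pos hε)) : ∀ᶠ j in cofinite, B j < ε / 2)
  have h2 : ∀ᶠ k in atTop, ∀ j ∈ {j | ¬ B j < ε / 2}, ‖F j k - l j‖ ≤ ε / 2 := by
    rw [eventually_all_finite h1]
    intro j _
    have := Metric.tendsto_nhds.mp (hl j) (ε / 2) (half_pos hε)
    filter_upwards [this] with k hk
    rw [dist_eq_norm] at hk
    exact hk.le
  obtain ⟨k₀, hk₀⟩ := eventually_atTop.mp h2
  refine ⟨k₀, fun k hk => ?_⟩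
  rw [dist_eq_norm]
  refine lt_of_le_of_lt (norm_le_of_hasSum (half_pos hε).le ((hS k).sub hs) fun j => ?_)
    (half_lt_self hε)
  by_cases hj : B j < ε / 2
  · have hlj : ‖l j‖ ≤ ε / 2 :=
      le_of_tendsto (hl j).norm (Eventually.of_forall fun k => (hF j k).trans hj.le)
    refine (norm_sub_le_max _ _).trans (max_le ((hF j k).trans hj.le) hlj)
  · exact hk₀ k hk j hj

end Sums

/-! ### Means over roots of unity and the Cauchy estimate -/

section RootMean

variable {K : Type*} [NormedField K]

/-- The mean value of `g` over the `N`-th roots of unity (in a field that contains `N` of them). -/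
noncomputable def rootMean (N : ℕ) (g : K → K) : K :=
  (N : K)⁻¹ * ∑ ζ ∈ Polynomial.nthRootsFinset N (1 : K), g ζ

theorem rootMean_const_mul (N : ℕ) (c : K) (g : K → K) :
    rootMean N (fun ζ => c * g ζ) = c * rootMean N g := by
  simp only [rootMean, ← Finset.mul_sum]
  ring

theorem rootMean_sum {ι : Type*} (N : ℕ) (s : Finset ι) (g : ι → K → K) :
    rootMean N (fun ζ => ∑ i ∈ s, g i ζ) = ∑ i ∈ s, rootMean N (g i) := by
  simp only [rootMean]
  rw [Finset.sum_comm, Finset.mul_sum]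

theorem rootMean_congr {N : ℕ} (hN : 0 < N) {g g' : K → K} (h : ∀ ζ, ζ ^ N = 1 → g ζ = g' ζ) :
    rootMean N g = rootMean N g' := by
  rw [rootMean, rootMean]
  congr 1
  exact Finset.sum_congr rfl fun ζ hζ => h ζ ((Polynomial.mem_nthRootsFinset hN 1).mp hζ)

theorem hasSum_rootMean {ι : Type*} {N : ℕ} (hN : 0 < N) {g : ι → K → K} {f : K → K}
    (h : ∀ ζ, ζ ^ N = 1 → HasSum (fun i => g i ζ) (f ζ)) :
    HasSum (fun i => rootMean N (g i)) (rootMean N f) :=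
  (hasSum_sum fun ζ hζ => h ζ ((Polynomial.mem_nthRootsFinset hN 1).mp hζ)).mul_left _

theorem norm_eq_one_of_pow_eq_one {ζ : K} {N : ℕ} (hN : 0 < N) (h : ζ ^ N = 1) : ‖ζ‖ = 1 := by
  have := congrArg norm h
  rw [norm_pow, norm_one] at this
  exact (pow_eq_one_iff_of_nonneg (norm_nonneg _) hN.ne').mp this

theorem norm_natCast_eq_one_of_norm_lt_one [IsUltrametricDist K] {p : ℕ} (hp : ‖(p : K)‖ < 1)
    (k : ℕ) : ‖((p * k + 1 : ℕ) : K)‖ = 1 := by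
  have h : ‖((p * k : ℕ) : K)‖ < 1 := by
    rw [Nat.cast_mul, norm_mul]
    exact mul_lt_one_of_nonneg_of_lt_one_left (norm_nonneg _) hp
      (IsUltrametricDist.norm_natCast_le_one K k)
  rw [Nat.cast_add, Nat.cast_one,
    IsUltrametricDist.norm_add_eq_max_of_norm_ne_norm (by rw [norm_one]; exact h.ne), norm_one,
    max_eq_right h.le]

variable [IsAlgClosed K] [CharZero K]

theorem rootMean_zpow {N : ℕ} (hN : 0 < N) (m : ℤ) :
    rootMean N (fun ζ : K => ζ ^ m) = if (N : ℤ) ∣ m then 1 else 0 := by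
  have : NeZero N := ⟨hN.ne'⟩
  obtain ⟨ξ, hξ⟩ := HasEnoughRootsOfUnity.exists_primitiveRoot K N
  have hN0 : (N : K) ≠ 0 := Nat.cast_ne_zero.mpr hN.ne'
  have hmem : ∀ ζ : K, ζ ∈ Polynomial.nthRootsFinset N (1 : K) ↔ ζ ^ N = 1 :=
    fun ζ => Polynomial.mem_nthRootsFinset hN 1
  have hξ0 : ξ ≠ 0 := hξ.ne_zero hN.ne'
  split_ifs with hd
  · have : ∀ ζ ∈ Polynomial.nthRootsFinset N (1 : K), ζ ^ m = 1 := by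
      intro ζ hζ
      obtain ⟨k, rfl⟩ := hd
      rw [zpow_mul, zpow_natCast, (hmem ζ).mp hζ, one_zpow]
    rw [rootMean, Finset.sum_congr rfl this, Finset.sum_const, hξ.card_nthRootsFinset, nsmul_one,
      inv_mul_cancel₀ hN0]
  · have h1 : ξ ^ m ≠ 1 := fun h => hd ((hξ.zpow_eq_one_iff_dvd m).mp h)
    have h2 : ξ ^ m * ∑ ζ ∈ Polynomial.nthRootsFinset N (1 : K), ζ ^ m =
        ∑ ζ ∈ Polynomial.nthRootsFinset N (1 : K), ζ ^ m := by
      rw [Finset.mul_sum]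
      refine Finset.sum_bij (fun ζ _ => ξ * ζ) (fun ζ hζ => ?_) (fun ζ _ ζ' _ h => ?_)
        (fun ζ hζ => ⟨ξ⁻¹ * ζ, ?_, ?_⟩) (fun ζ _ => (mul_zpow ξ ζ m).symm)
      · rw [hmem] at hζ ⊢
        rw [mul_pow, hξ.pow_eq_one, hζ, one_mul]
      · exact mul_left_cancel₀ hξ0 h
      · rw [hmem] at hζ ⊢
        rw [mul_pow, inv_pow, hξ.pow_eq_one, hζ, inv_one, one_mul]
      · rw [mul_inv_cancel_left₀ hξ0]
    have h3 : (ξ ^ m - 1) * ∑ ζ ∈ Polynomial.nthRootsFinset N (1 : K), ζ ^ m = 0 := by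
      rw [sub_mul, h2, one_mul, sub_self]
    rw [rootMean, (mul_eq_zero.mp h3).resolve_left (sub_ne_zero.mpr h1), mul_zero]

/-- **Cauchy's estimate** for a Laurent series on a circle. The mean of `g (y ζ) ζ⁻ⁿ` over the
`N`-th roots of unity `ζ` is `u n * y ^ n` up to the terms whose index differs from `n` by a
multiple of `N`, which are small for large `N`; and for `N ≡ 1` modulo `p` the factor `N⁻¹` of the
mean has norm one. -/
theorem norm_coeff_mul_zpow_le [IsUltrametricDist K] {p : ℕ} (hp0 : 0 < p) (hp : ‖(p : K)‖ < 1)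
    {u : ℤ → K} {g : K → K} {y : K} {C : ℝ}
    (hu : ∀ t, ‖t‖ = ‖y‖ → HasSum (fun n : ℤ => u n * t ^ n) (g t))
    (hg : ∀ t, ‖t‖ = ‖y‖ → ‖g t‖ ≤ C) (n : ℤ) : ‖u n‖ * ‖y‖ ^ n ≤ C := by
  have hC : 0 ≤ C := (norm_nonneg _).trans (hg y rfl)
  refine le_of_forall_pos_le_add fun ε hε => ?_
  have hfin : {k : ℤ | ¬ ‖u k * y ^ k‖ < ε}.Finite := by
    have : ∀ᶠ k in cofinite, ‖u k * y ^ k‖ < ε := by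
      filter_upwards [Metric.tendsto_nhds.mp (hu y rfl).summable.tendsto_cofinite_zero ε hε]
        with k hk
      rwa [dist_zero_right] at hk
    exact this
  obtain ⟨B, hB⟩ : ∃ B : ℕ, ∀ k ∈ {k : ℤ | ¬ ‖u k * y ^ k‖ < ε}, (k - n).natAbs ≤ B := by
    obtain ⟨B, hB⟩ := (hfin.image fun k => (k - n).natAbs).bddAbove
    exact ⟨B, fun k hk => hB ⟨k, hk, rfl⟩⟩
  set N := p * B + 1 with hN
  have hNpos : 0 < N := Nat.succ_pos _
  have hBN : B < N := by
    have := Nat.le_mul_of_pos_left B hp0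
    omega
  have hN1 : ‖(N : K)‖ = 1 := norm_natCast_eq_one_of_norm_lt_one hp B
  have hsum : HasSum (fun k => rootMean N fun ζ => ζ ^ (-n) * (u k * (y * ζ) ^ k))
      (rootMean N fun ζ => ζ ^ (-n) * g (y * ζ)) := by
    refine hasSum_rootMean hNpos fun ζ hζ => (hu _ ?_).mul_left _
    rw [norm_mul, norm_eq_one_of_pow_eq_one hNpos hζ, mul_one]
  have hterm : ∀ k, rootMean N (fun ζ => ζ ^ (-n) * (u k * (y * ζ) ^ k)) =
      if (N : ℤ) ∣ k - n then u k * y ^ k else 0 := by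
    intro k
    have : rootMean N (fun ζ => ζ ^ (-n) * (u k * (y * ζ) ^ k)) =
        rootMean N (fun ζ : K => (u k * y ^ k) * ζ ^ (k - n)) := by
      refine rootMean_congr hNpos fun ζ hζ => ?_
      have hζ0 : ζ ≠ 0 := by
        rintro rfl
        simp [hNpos.ne'] at hζ
      rw [mul_zpow, sub_eq_add_neg, zpow_add₀ hζ0]
      ring
    rw [this, rootMean_const_mul, rootMean_zpow hNpos]
    split_ifs <;> simp
  simp only [hterm] at hsum
  have hmean : ‖rootMean N fun ζ => ζ ^ (-n) * g (y * ζ)‖ ≤ C := by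
    rw [rootMean, norm_mul, norm_inv, hN1, inv_one, one_mul]
    refine IsUltrametricDist.norm_sum_le_of_forall_le_of_nonneg hC fun ζ hζ => ?_
    have hζ1 := norm_eq_one_of_pow_eq_one hNpos ((Polynomial.mem_nthRootsFinset hNpos 1).mp hζ)
    rw [norm_mul, norm_zpow, hζ1, one_zpow, one_mul]
    exact hg _ (by rw [norm_mul, hζ1, mul_one])
  have hsingle : HasSum (fun k => if k = n then u n * y ^ n else 0) (u n * y ^ n) :=
    hasSum_ite_eq n _
  have hdiff : ‖(rootMean N fun ζ => ζ ^ (-n) * g (y * ζ)) - u n * y ^ n‖ ≤ ε := by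
    refine norm_le_of_hasSum hε.le (hsum.sub hsingle) fun k => ?_
    rcases eq_or_ne k n with rfl | hk
    · simpa using hε.le
    · rw [if_neg hk, sub_zero]
      split_ifs with hd
      · by_contra hlt
        have h1 := hB k fun h => hlt h.le
        have h2 := Nat.le_of_dvd (Int.natAbs_pos.mpr (sub_ne_zero.mpr hk))
          (Int.natCast_dvd.mp hd)
        omega
      · simpa using hε.le
  rw [← norm_zpow, ← norm_mul]
  calc ‖u n * y ^ n‖ = ‖(rootMean N fun ζ => ζ ^ (-n) * g (y * ζ)) -
        ((rootMean N fun ζ => ζ ^ (-n) * g (y * ζ)) - u n * y ^ n)‖ := by rw [sub_sub_cancel]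
    _ ≤ _ := norm_sub_le _ _
    _ ≤ C + ε := add_le_add hmean hdiff

end RootMean

/-- The norm of an algebraically closed field takes values in every interval of positive reals. -/
theorem exists_norm_mem_Ioo {K : Type*} [NontriviallyNormedField K] [IsAlgClosed K] {s t : ℝ}
    (hs : 0 < s) (hst : s < t) : ∃ y : K, s < ‖y‖ ∧ ‖y‖ < t := by
  obtain ⟨c, hc⟩ := NormedField.exists_one_lt_norm K
  have h1 : 1 < t / s := (one_lt_div hs).mpr hst
  obtain ⟨n, hn⟩ := pow_unbounded_of_one_lt ‖c‖ h1
  have hn0 : n ≠ 0 := by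
    rintro rfl
    rw [pow_zero] at hn
    exact absurd hn hc.le.not_gt
  obtain ⟨z, hz⟩ := IsAlgClosed.exists_pow_nat_eq c (Nat.pos_of_ne_zero hn0)
  have hzn : ‖z‖ ^ n = ‖c‖ := by rw [← norm_pow, hz]
  have hz1 : 1 < ‖z‖ := by
    by_contra h
    have := pow_le_one₀ (n := n) (norm_nonneg z) (not_lt.mp h)
    rw [hzn] at this
    exact absurd hc this.not_gt
  have hz2 : ‖z‖ < t / s := by
    refine lt_of_pow_lt_pow_left₀ n (by positivity) (hzn ▸ hn)
  obtain ⟨k, hk⟩ := exists_mem_Ico_zpow hs hz1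
  have hz0 : z ≠ 0 := norm_pos_iff.mp (zero_lt_one.trans hz1)
  refine ⟨z ^ (k + 1), by rw [norm_zpow]; exact hk.2, ?_⟩
  rw [norm_zpow, zpow_add_one₀ (norm_ne_zero_iff.mpr hz0)]
  calc ‖z‖ ^ k * ‖z‖ ≤ s * ‖z‖ := by gcongr; exact hk.1
    _ < s * (t / s) := by gcongr
    _ = t := by field_simp

/-! ### Mittag-Leffler expansions on a disc with holes -/

section MittagLeffler

variable {K : Type*} [NormedField K] {M : ℕ}

/-- The closed disc with centre `b` and radius `R` without the open discs with centres `x i` and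
radii `r i`. -/
def holedDisc (b : K) (R : ℝ) (x : Fin M → K) (r : Fin M → ℝ) : Set K :=
  {z | ‖z - b‖ ≤ R ∧ ∀ i, r i ≤ ‖z - x i‖}

/-- The functions in which analytic functions on a disc with holes are expanded: the powers
`(z - b) ^ m` and, for each hole, the negative powers `(z - x i) ^ (-(m + 1))`. -/
def mlBasis (b : K) (x : Fin M → K) : ℕ ⊕ Fin M × ℕ → K → K
  | .inl m, z => (z - b) ^ m
  | .inr (i, m), z => ((z - x i) ^ (m + 1))⁻¹

/-- An upper bound for the norm of the functions `mlBasis` on `holedDisc`. -/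
noncomputable def mlWeight (R : ℝ) (r : Fin M → ℝ) : ℕ ⊕ Fin M × ℕ → ℝ
  | .inl m => R ^ m
  | .inr (i, m) => (r i ^ (m + 1))⁻¹

/-- `c` is the family of the coefficients in a Mittag-Leffler expansion of `F`: the series
`∑ j, c j * mlBasis b x j z` converges uniformly on the disc with holes, with sum `F`. -/
def IsMittagLeffler (b : K) (R : ℝ) (x : Fin M → K) (r : Fin M → ℝ)
    (F : holedDisc b R x r → K) (c : ℕ ⊕ Fin M × ℕ → K) : Prop :=
  Tendsto (fun j => ‖c j‖ * mlWeight R r j) cofinite (𝓝 0) ∧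
    ∀ z : holedDisc b R x r, HasSum (fun j => c j * mlBasis b x j z) (F z)

variable {b : K} {R : ℝ} {x : Fin M → K} {r : Fin M → ℝ}

theorem mlWeight_pos (hR : 0 < R) (hr : ∀ i, 0 < r i) (j : ℕ ⊕ Fin M × ℕ) :
    0 < mlWeight R r j := by
  rcases j with m | ⟨i, m⟩
  · exact pow_pos hR m
  · exact inv_pos.mpr (pow_pos (hr i) _)

theorem norm_mlBasis_le (hr : ∀ i, 0 < r i) {z : K} (hz : z ∈ holedDisc b R x r)
    (j : ℕ ⊕ Fin M × ℕ) : ‖mlBasis b x j z‖ ≤ mlWeight R r j := by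
  rcases j with m | ⟨i, m⟩
  · simp only [mlBasis, mlWeight, norm_pow]
    exact pow_le_pow_left₀ (norm_nonneg _) hz.1 m
  · simp only [mlBasis, mlWeight, norm_inv, norm_pow]
    exact inv_anti₀ (pow_pos (hr i) _) (pow_le_pow_left₀ (hr i).le (hz.2 i) _)

theorem IsMittagLeffler.add {F G : holedDisc b R x r → K} {c d : ℕ ⊕ Fin M × ℕ → K}
    (hR : 0 < R) (hr : ∀ i, 0 < r i) (hF : IsMittagLeffler b R x r F c)
    (hG : IsMittagLeffler b R x r G d) : IsMittagLeffler b R x r (F + G) (c + d) := by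
  refine ⟨squeeze_zero (fun j => mul_nonneg (norm_nonneg _) (mlWeight_pos hR hr j).le)
    (fun j => ?_) (by simpa using hF.1.add hG.1), fun z => ?_⟩
  · rw [← add_mul]
    exact mul_le_mul_of_nonneg_right (norm_add_le _ _) (mlWeight_pos hR hr j).le
  · simpa only [Pi.add_apply, add_mul] using (hF.2 z).add (hG.2 z)

theorem IsMittagLeffler.smul {F : holedDisc b R x r → K} {c : ℕ ⊕ Fin M × ℕ → K} (s : K)
    (hF : IsMittagLeffler b R x r F c) : IsMittagLeffler b R x r (s • F) (s • c) := by
  refine ⟨?_, fun z => ?_⟩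
  · simpa [mul_assoc] using hF.1.const_mul ‖s‖
  · simpa [mul_assoc] using (hF.2 z).mul_left s

theorem IsMittagLeffler.sub {F G : holedDisc b R x r → K} {c d : ℕ ⊕ Fin M × ℕ → K}
    (hR : 0 < R) (hr : ∀ i, 0 < r i) (hF : IsMittagLeffler b R x r F c)
    (hG : IsMittagLeffler b R x r G d) : IsMittagLeffler b R x r (F - G) (c - d) := by
  simpa [sub_eq_add_neg] using hF.add hR hr (hG.smul (-1))

theorem isMittagLeffler_zero : IsMittagLeffler b R x r 0 0 :=
  ⟨by simp, fun z => by simp⟩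

theorem apply_extend {ι κ A B : Type*} [Zero A] [Zero B] {φ : ι → κ} (hφ : φ.Injective)
    {d : ι → A} (q : A → κ → B) (hq : ∀ j, q 0 j = 0) :
    (fun j => q (Function.extend φ d 0 j) j) = Function.extend φ (fun n => q (d n) (φ n)) 0 := by
  funext j
  by_cases hj : ∃ n, φ n = j
  · obtain ⟨n, rfl⟩ := hj
    rw [hφ.extend_apply, hφ.extend_apply]
  · rw [Function.extend_apply' _ _ _ hj, Function.extend_apply' _ _ _ hj]
    exact hq j

/-- A Mittag-Leffler expansion whose nonzero coefficients are indexed by `φ`. -/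
theorem isMittagLeffler_extend {φ : ℕ → ℕ ⊕ Fin M × ℕ} (hφ : φ.Injective) {d : ℕ → K}
    {F : holedDisc b R x r → K}
    (hd : Tendsto (fun n => ‖d n‖ * mlWeight R r (φ n)) atTop (𝓝 0))
    (hF : ∀ z : holedDisc b R x r, HasSum (fun n => d n * mlBasis b x (φ n) z) (F z)) :
    IsMittagLeffler b R x r F (Function.extend φ d 0) := by
  refine ⟨?_, fun z => ?_⟩
  · rw [apply_extend hφ (fun s j => ‖s‖ * mlWeight R r j) (by simp), Metric.tendsto_nhds]
    intro ε hε
    have h := (Nat.cofinite_eq_atTop ▸ Metric.tendsto_nhds.mp hd ε hε :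
      ∀ᶠ n in cofinite, dist (‖d n‖ * mlWeight R r (φ n)) 0 < ε)
    refine Set.Finite.subset (Set.Finite.image φ (h : Set.Finite {n | ¬ _})) fun j hj => ?_
    by_cases hj' : ∃ n, φ n = j
    · obtain ⟨n, rfl⟩ := hj'
      refine ⟨n, fun h => hj ?_, rfl⟩
      simpa only [Set.mem_ofPred_eq, hφ.extend_apply] using h
    · refine absurd ?_ hj
      simpa only [Set.mem_ofPred_eq, Function.extend_apply' _ _ _ hj', Pi.zero_apply, dist_self]
  · rw [apply_extend hφ (fun s j => s * mlBasis b x j (z : K)) (by simp)]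
    exact (hasSum_extend_zero hφ).mpr (hF z)

/-- The functions on a disc with holes that have a Mittag-Leffler expansion. -/
def mlSubmodule (b : K) {R : ℝ} (x : Fin M → K) {r : Fin M → ℝ} (hR : 0 < R)
    (hr : ∀ i, 0 < r i) : Submodule K (holedDisc b R x r → K) where
  carrier := {F | ∃ c, IsMittagLeffler b R x r F c}
  add_mem' := fun ⟨_, hc⟩ ⟨_, hd⟩ => ⟨_, hc.add hR hr hd⟩
  zero_mem' := ⟨0, isMittagLeffler_zero⟩
  smul_mem' := fun s _ ⟨_, hc⟩ => ⟨_, hc.smul s⟩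

theorem eval_mem_mlSubmodule (hR : 0 < R) (hr : ∀ i, 0 < r i) (P : Polynomial K) :
    (fun z : holedDisc b R x r => P.eval (z : K)) ∈ mlSubmodule b x hR hr := by
  refine ⟨_, isMittagLeffler_extend (φ := Sum.inl) Sum.inl_injective
    (d := fun n => (Polynomial.taylor b P).coeff n) ?_ fun z => ?_⟩
  · refine tendsto_const_nhds.congr' ?_
    filter_upwards [eventually_gt_atTop (Polynomial.taylor b P).natDegree] with n hn
    rw [Polynomial.coeff_eq_zero_of_natDegree_lt hn, norm_zero, zero_mul]
  · have h : P.eval (z : K) = (Polynomial.taylor b P).eval (z - b) := by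
      rw [Polynomial.taylor_eval, sub_add_cancel]
    rw [h, Polynomial.eval_eq_sum_range]
    refine hasSum_sum_of_ne_finset_zero fun n hn => ?_
    rw [Finset.mem_range, not_lt, Nat.succ_le_iff] at hn
    rw [Polynomial.coeff_eq_zero_of_natDegree_lt hn, zero_mul]

theorem hasSum_inv_sub_pow (m : ℕ) {t v : K} (h : ‖t‖ < ‖v‖) :
    HasSum (fun n : ℕ => ((n + m).choose m : K) * ((-v) ^ (m + 1))⁻¹ * v⁻¹ ^ n * t ^ n)
      (((t - v) ^ (m + 1))⁻¹) := by
  have hv : v ≠ 0 := norm_pos_iff.mp ((norm_nonneg t).trans_lt h)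
  have h1 : ‖t * v⁻¹‖ < 1 := by
    rw [norm_mul, norm_inv, ← div_eq_mul_inv]
    exact (div_lt_one (norm_pos_iff.mpr hv)).mpr h
  have h2 := (hasSum_choose_mul_geometric_of_norm_lt_one m h1).mul_left (((-v) ^ (m + 1))⁻¹)
  have h3 : (-v) * (1 - t * v⁻¹) = t - v := by
    field_simp
    ring
  rw [one_div, ← mul_inv, ← mul_pow, h3] at h2
  refine h2.congr_fun fun n => ?_
  rw [mul_pow]
  ring

theorem norm_choose_mul_inv_le [IsUltrametricDist K] (m n : ℕ) (v : K) :
    ‖((n + m).choose m : K) * ((-v) ^ (m + 1))⁻¹ * v⁻¹ ^ n‖ ≤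
      (‖v‖ ^ (m + 1))⁻¹ * ‖v‖⁻¹ ^ n := by
  rw [mul_assoc, norm_mul, norm_mul, norm_inv, norm_pow, norm_pow, norm_inv, norm_neg]
  exact mul_le_of_le_one_left (by positivity) (IsUltrametricDist.norm_natCast_le_one K _)

theorem inv_sub_pow_mem_mlSubmodule [IsUltrametricDist K] (hR : 0 < R) (hr : ∀ i, 0 < r i)
    (m : ℕ) {v : K} (hv : v ∉ holedDisc b R x r) :
    (fun z : holedDisc b R x r => (((z : K) - v) ^ (m + 1))⁻¹) ∈ mlSubmodule b x hR hr := by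
  by_cases hvb : ‖v - b‖ ≤ R
  · -- `v` lies in a hole, and the function is a power series in `(z - x i)⁻¹`.
    obtain ⟨i, hi⟩ : ∃ i, ‖v - x i‖ < r i := by
      by_contra! h
      exact hv ⟨hvb, h⟩
    refine ⟨_, isMittagLeffler_extend (φ := fun n => Sum.inr (i, n + m))
      (fun n n' h => by simpa using h) (d := fun n => ((n + m).choose m : K) * (v - x i) ^ n)
      ?_ fun z => ?_⟩
    · have h1 : ‖v - x i‖ / r i < 1 := (div_lt_one (hr i)).mpr hi
      have h2 := (tendsto_pow_atTop_nhds_zero_of_lt_one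
        (div_nonneg (norm_nonneg _) (hr i).le) h1).mul_const ((r i ^ (m + 1))⁻¹)
      rw [zero_mul] at h2
      refine squeeze_zero (fun n => mul_nonneg (norm_nonneg _) (mlWeight_pos hR hr _).le)
        (fun n => ?_) h2
      have h3 : mlWeight R r (Sum.inr (i, n + m)) = (r i ^ n)⁻¹ * (r i ^ (m + 1))⁻¹ := by
        rw [mlWeight, ← mul_inv, ← pow_add, add_assoc]
      rw [h3, ← mul_assoc, div_pow, div_eq_mul_inv, norm_mul, norm_pow]
      have := (hr i).le
      gcongr
      exact mul_le_of_le_one_left (by positivity) (IsUltrametricDist.norm_natCast_le_one K _)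
    · have hz := z.2.2 i
      have hz0 : (z : K) - x i ≠ 0 := norm_pos_iff.mp ((hr i).trans_le hz)
      have h1 : ‖(v - x i) * ((z : K) - x i)⁻¹‖ < 1 := by
        rw [norm_mul, norm_inv, ← div_eq_mul_inv]
        exact (div_lt_one (norm_pos_iff.mpr hz0)).mpr (hi.trans_le hz)
      have h2 := (hasSum_choose_mul_geometric_of_norm_lt_one m h1).mul_left
        ((((z : K) - x i) ^ (m + 1))⁻¹)
      have h3 : ((z : K) - x i) * (1 - (v - x i) * ((z : K) - x i)⁻¹) = z - v := by
        field_simp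
        ring
      rw [one_div, ← mul_inv, ← mul_pow, h3] at h2
      refine h2.congr_fun fun n => ?_
      rw [mlBasis, mul_pow, inv_pow, add_assoc, pow_add _ n, mul_inv]
      ring
  · push Not at hvb
    refine ⟨_, isMittagLeffler_extend (φ := Sum.inl) Sum.inl_injective
      (d := fun n => ((n + m).choose m : K) * ((-(v - b)) ^ (m + 1))⁻¹ * (v - b)⁻¹ ^ n)
      ?_ fun z => ?_⟩
    · have hv0 : 0 < ‖v - b‖ := hR.trans hvb
      have h1 : R / ‖v - b‖ < 1 := (div_lt_one hv0).mpr hvb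
      have h2 := (tendsto_pow_atTop_nhds_zero_of_lt_one
        (div_nonneg hR.le (norm_nonneg _)) h1).const_mul ((‖v - b‖ ^ (m + 1))⁻¹)
      rw [mul_zero] at h2
      refine squeeze_zero (fun n => mul_nonneg (norm_nonneg _) (mlWeight_pos hR hr _).le)
        (fun n => ?_) h2
      refine (mul_le_mul_of_nonneg_right (norm_choose_mul_inv_le m n (v - b))
        (mlWeight_pos hR hr _).le).trans_eq ?_
      rw [mlWeight, div_pow, inv_pow]
      ring
    · have := hasSum_inv_sub_pow m (z.2.1.trans_lt hvb)
      rwa [sub_sub_sub_cancel_right] at this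

/-- The span of the polynomials and of the functions `(z - v) ^ (-(m + 1))` with a pole `v`
outside `D`, as functions on `D`. -/
def partialFractions (D : Set K) : Submodule K (D → K) :=
  Submodule.span K (Set.range (fun (P : Polynomial K) (z : D) => P.eval (z : K)) ∪
    {F | ∃ v ∉ D, ∃ m : ℕ, F = fun z : D => (((z : K) - v) ^ (m + 1))⁻¹})

theorem inv_sub_pow_mem_partialFractions {D : Set K} {v : K} (hv : v ∉ D) (m : ℕ) :
    (fun z : D => (((z : K) - v) ^ (m + 1))⁻¹) ∈ partialFractions D :=
  Submodule.subset_span (Or.inr ⟨v, hv, m, rfl⟩)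

theorem eval_mem_partialFractions {D : Set K} (P : Polynomial K) :
    (fun z : D => P.eval (z : K)) ∈ partialFractions D :=
  Submodule.subset_span (Or.inl ⟨P, rfl⟩)

theorem mul_inv_sub_mem_partialFractions {D : Set K} {F : D → K} (hF : F ∈ partialFractions D)
    {v : K} (hv : v ∉ D) : (fun z : D => F z * ((z : K) - v)⁻¹) ∈ partialFractions D := by
  have hne : ∀ {w : K}, w ∉ D → ∀ z : D, (z : K) - w ≠ 0 := fun hw z h =>
    hw (sub_eq_zero.mp h ▸ z.2)
  have hv1 : (fun z : D => ((z : K) - v)⁻¹) ∈ partialFractions D := by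
    simpa using inv_sub_pow_mem_partialFractions hv 0
  induction hF using Submodule.span_induction with
  | mem F h =>
    rcases h with ⟨P, rfl⟩ | ⟨w, hw, m, rfl⟩
    · have h1 : (fun z : D => P.eval (z : K) * ((z : K) - v)⁻¹) =
          (fun z : D => (P /ₘ (Polynomial.X - Polynomial.C v)).eval (z : K)) +
            P.eval v • fun z : D => ((z : K) - v)⁻¹ := by
        funext z
        have h2 := congrArg (Polynomial.eval (z : K))
          (Polynomial.modByMonic_add_div P (Polynomial.X - Polynomial.C v))
        rw [Polynomial.modByMonic_X_sub_C_eq_C_eval, Polynomial.eval_add, Polynomial.eval_mul,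
          Polynomial.eval_C, Polynomial.eval_sub, Polynomial.eval_X, Polynomial.eval_C] at h2
        simp only [Pi.add_apply, Pi.smul_apply, smul_eq_mul]
        rw [← h2]
        have := hne hv z
        field_simp
        ring
      rw [h1]
      exact add_mem (eval_mem_partialFractions _) (Submodule.smul_mem _ _ hv1)
    · rcases eq_or_ne w v with rfl | hwv
      · simpa only [pow_succ _ (m + 1), mul_inv] using inv_sub_pow_mem_partialFractions hw (m + 1)
      · -- `1 / ((z - w) (z - v)) = (1 / (z - v) - 1 / (z - w)) / (v - w)`, by induction on `m`.
        have step : ∀ G : D → K, (fun z : D => G z * ((z : K) - v)⁻¹) ∈ partialFractions D →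
            (fun z : D => G z * ((z : K) - w)⁻¹) ∈ partialFractions D →
            (fun z : D => G z * ((z : K) - w)⁻¹ * ((z : K) - v)⁻¹) ∈ partialFractions D := by
          intro G h1 h2
          have h3 : (fun z : D => G z * ((z : K) - w)⁻¹ * ((z : K) - v)⁻¹) =
              (v - w)⁻¹ • ((fun z : D => G z * ((z : K) - v)⁻¹) -
                fun z : D => G z * ((z : K) - w)⁻¹) := by
            funext z
            have hz1 := hne hv z
            have hz2 := hne hw z
            have hz3 := sub_ne_zero.mpr hwv.symm
            simp only [Pi.smul_apply, Pi.sub_apply, smul_eq_mul]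
            field_simp
            ring
          rw [h3]
          exact Submodule.smul_mem _ _ (sub_mem h1 h2)
        induction m with
        | zero =>
          simpa using step 1 (by simpa using hv1)
            (by simpa using inv_sub_pow_mem_partialFractions hw 0)
        | succ m ih =>
          have := step (fun z : D => (((z : K) - w) ^ (m + 1))⁻¹) ih (by
            simpa only [pow_succ _ (m + 1), mul_inv] using
              inv_sub_pow_mem_partialFractions hw (m + 1))
          simpa only [pow_succ _ (m + 1), mul_inv] using this
  | zero => simp only [Pi.zero_apply, zero_mul]; exact zero_mem _
  | add F G _ _ hF hG => 
    simp only [Pi.add_apply, add_mul]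
    exact add_mem hF hG
  | smul s F _ hF => 
    simp only [Pi.smul_apply, smul_eq_mul, mul_assoc]
    exact Submodule.smul_mem _ s hF

/-- A rational function without poles in `D` has a partial fraction decomposition. -/
theorem eval_div_eval_mem_partialFractions [IsAlgClosed K] {D : Set K} (P : Polynomial K)
    {Q : Polynomial K} (hQ : ∀ z ∈ D, Q.eval z ≠ 0) :
    (fun z : D => P.eval (z : K) / Q.eval (z : K)) ∈ partialFractions D := by
  have key : ∀ s : Multiset K, (∀ v ∈ s, v ∉ D) →
      (fun z : D => P.eval (z : K) * (s.map fun v => ((z : K) - v)⁻¹).prod) ∈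
        partialFractions D := by
    intro s
    induction s using Multiset.induction with
    | empty => simpa using eval_mem_partialFractions P
    | cons v s ih =>
      intro hs
      have := mul_inv_sub_mem_partialFractions
        (ih fun w hw => hs w (Multiset.mem_cons_of_mem hw)) (hs v (Multiset.mem_cons_self v s))
      convert this using 2 with z
      rw [Multiset.map_cons, Multiset.prod_cons]
      ring
  have h1 := Submodule.smul_mem _ Q.leadingCoeff⁻¹
    (key Q.roots fun v hv hvD => hQ v hvD (Polynomial.isRoot_of_mem_roots hv))
  convert h1 using 1
  funext z
  have h2 := congrArg (Polynomial.eval (z : K)) (IsAlgClosed.splits Q).eq_prod_roots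
  rw [Polynomial.eval_mul, Polynomial.eval_C, Polynomial.eval_multiset_prod,
    Multiset.map_map] at h2
  rw [h2, Pi.smul_apply, smul_eq_mul, div_eq_mul_inv, mul_inv, ← Multiset.prod_map_inv]
  simp only [Function.comp, Polynomial.eval_sub, Polynomial.eval_X, Polynomial.eval_C]
  ring

theorem exists_isMittagLeffler_eval_div_eval [IsUltrametricDist K] [IsAlgClosed K] (hR : 0 < R)
    (hr : ∀ i, 0 < r i) (P : Polynomial K) {Q : Polynomial K}
    (hQ : ∀ z ∈ holedDisc b R x r, Q.eval z ≠ 0) :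
    ∃ c, IsMittagLeffler b R x r (fun z => P.eval (z : K) / Q.eval (z : K)) c := by
  have h : partialFractions (holedDisc b R x r) ≤ mlSubmodule b x hR hr := by
    refine Submodule.span_le.mpr ?_
    rintro _ (⟨P, rfl⟩ | ⟨v, hv, m, rfl⟩)
    · exact eval_mem_mlSubmodule hR hr P
    · exact inv_sub_pow_mem_mlSubmodule hR hr m hv
  exact h (eval_div_eval_mem_partialFractions P hQ)

end MittagLeffler

/-! ### Laurent expansions at the holes and coefficient estimates -/

theorem hasSum_int_of_hasSum_nat {K : Type*} [NormedField K] {d : ℕ → K} {s t : K}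
    (h : HasSum (fun n : ℕ => d n * t ^ n) s) :
    HasSum (fun n : ℤ => (if 0 ≤ n then d n.toNat else 0) * t ^ n) s := by
  rw [← add_zero s]
  refine HasSum.of_nat_of_neg_add_one (by simpa using h) ?_
  convert hasSum_zero using 2 with n
  rw [if_neg (by omega), zero_mul]

/-- The hole around `x i` is contained in an annulus on which the other singularities do not
interfere. -/
theorem exists_annulus {K : Type*} [NormedField K] {M : ℕ} {R : ℝ} {x : Fin M → K}
    {r : Fin M → ℝ} (hrR : ∀ i, r i < R) (hsep : ∀ i j, i ≠ j → r i < ‖x j - x i‖)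
    (i : Fin M) : ∃ ρ, r i < ρ ∧ ρ ≤ R ∧ ∀ j, j ≠ i → ρ ≤ ‖x j - x i‖ := by
  have h1 : ∀ᶠ ρ in 𝓝[>] (r i), ρ ≤ R ∧ ∀ j, j ≠ i → ρ ≤ ‖x j - x i‖ := by
    refine Filter.Eventually.filter_mono nhdsWithin_le_nhds ?_
    refine (eventually_le_nhds (hrR i)).and (eventually_all.mpr fun j => ?_)
    by_cases hj : j = i
    · exact Eventually.of_forall fun _ h => absurd hj h
    · filter_upwards [eventually_le_nhds (hsep i j (Ne.symm hj))] with ρ hρ _ using hρ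
  obtain ⟨ρ, h2, h3⟩ := (h1.and self_mem_nhdsWithin).exists
  exact ⟨ρ, h3, h2⟩

section Laurent

variable {K : Type*} [NormedField K] [IsUltrametricDist K] {M : ℕ}
  {b : K} {R : ℝ} {x : Fin M → K} {r : Fin M → ℝ}

theorem norm_add_eq_right {s t : K} (h : ‖s‖ < ‖t‖) : ‖s + t‖ = ‖t‖ := by
  rw [IsUltrametricDist.norm_add_eq_max_of_norm_ne_norm h.ne, max_eq_right h.le]

theorem mem_holedDisc_of_mem_annulus (hxb : ∀ i, ‖x i - b‖ ≤ R)
    (hsep : ∀ i j, i ≠ j → r i < ‖x j - x i‖) {i : Fin M} {ρ : ℝ} (hρR : ρ ≤ R)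
    (hρ : ∀ j, j ≠ i → ρ ≤ ‖x j - x i‖) {t : K} (ht : r i ≤ ‖t‖) (htρ : ‖t‖ < ρ) :
    x i + t ∈ holedDisc b R x r := by
  refine ⟨?_, fun j => ?_⟩
  · rw [add_sub_right_comm]
    exact (IsUltrametricDist.norm_add_le_max _ _).trans (max_le (hxb i) (htρ.le.trans hρR))
  · rcases eq_or_ne j i with rfl | hj
    · rwa [add_sub_cancel_left]
    · rw [add_sub_right_comm, add_comm, norm_add_eq_right]
      · exact (hsep j i hj).le
      · rw [norm_sub_rev]
        exact htρ.trans_le (hρ j hj)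

/-- The Laurent expansion at a hole of the functions in `mlBasis`. Only the negative powers that
belong to this hole contribute to its principal part. -/
theorem exists_laurent_mlBasis (hr : ∀ i, 0 < r i) (hxb : ∀ i, ‖x i - b‖ ≤ R)
    (hsep : ∀ i j, i ≠ j → r i < ‖x j - x i‖) {i : Fin M} {ρ : ℝ} (hρR : ρ ≤ R)
    (hρ : ∀ j, j ≠ i → ρ ≤ ‖x j - x i‖) (j : ℕ ⊕ Fin M × ℕ) :
    ∃ L : ℤ → K, (∀ m : ℕ, L (-(m + 1)) = if j = Sum.inr (i, m) then 1 else 0) ∧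
      ∀ t, r i ≤ ‖t‖ → ‖t‖ < ρ → HasSum (fun n => L n * t ^ n) (mlBasis b x j (x i + t)) ∧
        ∀ n, ‖L n * t ^ n‖ ≤ mlWeight R r j := by
  -- For the functions without a pole in the hole the expansion is a power series.
  have key : ∀ d : ℕ → K, (∀ m : ℕ, j ≠ Sum.inr (i, m)) →
      (∀ t, r i ≤ ‖t‖ → ‖t‖ < ρ → HasSum (fun n => d n * t ^ n) (mlBasis b x j (x i + t)) ∧
        ∀ n, ‖d n * t ^ n‖ ≤ mlWeight R r j) →
      ∃ L : ℤ → K, (∀ m : ℕ, L (-(m + 1)) = if j = Sum.inr (i, m) then 1 else 0) ∧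
      ∀ t, r i ≤ ‖t‖ → ‖t‖ < ρ → HasSum (fun n => L n * t ^ n) (mlBasis b x j (x i + t)) ∧
        ∀ n, ‖L n * t ^ n‖ ≤ mlWeight R r j := by
    intro d hj hd
    refine ⟨fun n => if 0 ≤ n then d n.toNat else 0, fun m => ?_, fun t ht htρ =>
      ⟨hasSum_int_of_hasSum_nat (hd t ht htρ).1, fun n => ?_⟩⟩
    · simp only
      rw [if_neg (hj m), if_neg (by omega)]
    · have h0 := (norm_nonneg _).trans ((hd t ht htρ).2 0)
      simp only
      split_ifs with hn
      · obtain ⟨k, rfl⟩ := Int.eq_ofNat_of_zero_le hn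
        simpa using (hd t ht htρ).2 k
      · simpa using h0
  have hR : ∀ {t : K}, r i ≤ ‖t‖ → ‖t‖ < ρ → 0 < R := fun ht htρ =>
    (hr i).trans_le (ht.trans (htρ.le.trans hρR))
  rcases j with m | ⟨k, m⟩
  · refine key (fun n => (x i - b) ^ (m - n) * (m.choose n : K)) (by simp) fun t ht htρ =>
      ⟨?_, fun n => ?_⟩
    · rw [mlBasis, add_sub_right_comm, add_comm, add_pow]
      convert hasSum_sum_of_ne_finset_zero (s := Finset.range (m + 1))
        (L := SummationFilter.unconditional ℕ) ?_ using 1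
      · exact Finset.sum_congr rfl fun n _ => by ring
      · intro n hn
        rw [Finset.mem_range, not_lt, Nat.succ_le_iff] at hn
        rw [Nat.choose_eq_zero_of_lt hn, Nat.cast_zero, mul_zero, zero_mul]
    · rcases le_or_gt n m with hn | hn
      · have h1 : ‖(x i - b) ^ (m - n)‖ ≤ R ^ (m - n) := by
          rw [norm_pow]
          exact pow_le_pow_left₀ (norm_nonneg _) (hxb i) _
        have h2 : ‖t ^ n‖ ≤ R ^ n := by
          rw [norm_pow]
          exact pow_le_pow_left₀ (norm_nonneg _) (htρ.le.trans hρR) _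
        have h3 := (hR ht htρ).le
        rw [mlWeight, ← Nat.sub_add_cancel hn, pow_add, Nat.sub_add_cancel hn, norm_mul, norm_mul]
        refine mul_le_mul ?_ h2 (norm_nonneg _) (by positivity)
        exact (mul_le_of_le_one_right (norm_nonneg _)
          (IsUltrametricDist.norm_natCast_le_one K _)).trans h1
      · rw [Nat.choose_eq_zero_of_lt hn, Nat.cast_zero, mul_zero, zero_mul, norm_zero]
        exact (mlWeight_pos (hR ht htρ) hr _).le
  · rcases eq_or_ne k i with rfl | hki
    · refine ⟨fun n => if n = -((m : ℤ) + 1) then 1 else 0, fun m' => ?_, fun t ht htρ =>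
        ⟨?_, fun n => ?_⟩⟩
      · simp [eq_comm]
      · rw [mlBasis, add_sub_cancel_left]
        convert hasSum_ite_eq (-((m : ℤ) + 1)) ((t ^ (m + 1))⁻¹) using 2 with n
        simp only
        split_ifs with hn
        · rw [hn, one_mul, zpow_neg, ← Nat.cast_add_one, zpow_natCast]
        · rw [zero_mul]
      · simp only
        split_ifs with hn
        · rw [hn, one_mul, zpow_neg, ← Nat.cast_add_one, zpow_natCast, norm_inv, norm_pow]
          exact inv_anti₀ (pow_pos (hr k) _) (pow_le_pow_left₀ (hr k).le ht _)
        · rw [zero_mul, norm_zero]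
          exact (mlWeight_pos (hR ht htρ) hr _).le
    · refine key (fun n => ((n + m).choose m : K) * ((-(x k - x i)) ^ (m + 1))⁻¹ *
        (x k - x i)⁻¹ ^ n) (by simp [hki]) fun t ht htρ => ⟨?_, fun n => ?_⟩
      · rw [mlBasis, show x i + t - x k = t - (x k - x i) by ring]
        exact hasSum_inv_sub_pow m (htρ.trans_le (hρ k hki))
      · have h1 : ‖t‖ ≤ ‖x k - x i‖ := htρ.le.trans (hρ k hki)
        have h2 : 0 < ‖x k - x i‖ := (hr i).trans_le (ht.trans h1)
        have h3 : r k ≤ ‖x k - x i‖ := norm_sub_rev (x k) (x i) ▸ (hsep k i hki).le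
        rw [norm_mul, norm_pow t]
        calc _ ≤ (‖x k - x i‖ ^ (m + 1))⁻¹ * ‖x k - x i‖⁻¹ ^ n * ‖t‖ ^ n := by
              gcongr
              exact norm_choose_mul_inv_le m n _
          _ = (‖x k - x i‖ ^ (m + 1))⁻¹ * (‖t‖ / ‖x k - x i‖) ^ n := by
              rw [mul_assoc, ← mul_pow, div_eq_inv_mul]
          _ ≤ (‖x k - x i‖ ^ (m + 1))⁻¹ := mul_le_of_le_one_right (by positivity)
              (pow_le_one₀ (by positivity) ((div_le_one h2).mpr h1))
          _ ≤ _ := inv_anti₀ (pow_pos (hr k) _) (pow_le_pow_left₀ (hr k).le h3 _)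

/-- The principal part of a Mittag-Leffler expansion at a hole is the principal part of a Laurent
expansion. -/
theorem IsMittagLeffler.exists_laurent [CompleteSpace K] (hr : ∀ i, 0 < r i)
    (hxb : ∀ i, ‖x i - b‖ ≤ R) (hsep : ∀ i j, i ≠ j → r i < ‖x j - x i‖)
    {f : K → K} {c : ℕ ⊕ Fin M × ℕ → K}
    (hf : IsMittagLeffler b R x r (fun z => f z) c) {i : Fin M} {ρ : ℝ} (hρR : ρ ≤ R)
    (hρ : ∀ j, j ≠ i → ρ ≤ ‖x j - x i‖) :
    ∃ u : ℤ → K, (∀ m : ℕ, u (-(m + 1)) = c (Sum.inr (i, m))) ∧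
      ∀ t, r i ≤ ‖t‖ → ‖t‖ < ρ → HasSum (fun n => u n * t ^ n) (f (x i + t)) := by
  choose L hL1 hL2 using exists_laurent_mlBasis (b := b) hr hxb hsep hρR hρ
  refine ⟨fun n => ∑' j, c j * L j n, fun m => ?_, fun t ht htρ => ?_⟩
  · simp only [hL1]
    rw [tsum_eq_single (Sum.inr (i, m)) fun j hj => by rw [if_neg hj, mul_zero], if_pos rfl,
      mul_one]
  · have h := hasSum_tsum_comm (G := fun j n => c j * (L j n * t ^ n)) hf.1
      (fun j n => by
        rw [norm_mul]
        exact mul_le_mul_of_nonneg_left ((hL2 j t ht htρ).2 n) (norm_nonneg _))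
      (fun j => ((hL2 j t ht htρ).1).mul_left (c j))
      (hf.2 ⟨_, mem_holedDisc_of_mem_annulus hxb hsep hρR hρ ht htρ⟩)
    convert h using 2 with n
    rw [← tsum_mul_right]
    exact tsum_congr fun j => mul_assoc _ _ _

end Laurent

section Estimate

variable {K : Type*} [NontriviallyNormedField K] [IsUltrametricDist K] [CompleteSpace K]
  [IsAlgClosed K] [CharZero K] {M : ℕ} {b : K} {R : ℝ} {x : Fin M → K} {r : Fin M → ℝ}
  {p : ℕ}

/-- The coefficients of the principal parts are bounded by the supremum norm of the function. -/
theorem IsMittagLeffler.norm_inr_mul_le (hp0 : 0 < p) (hp : ‖(p : K)‖ < 1) (hr : ∀ i, 0 < r i)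
    (hrR : ∀ i, r i < R) (hxb : ∀ i, ‖x i - b‖ ≤ R) (hsep : ∀ i j, i ≠ j → r i < ‖x j - x i‖)
    {F : holedDisc b R x r → K} {c : ℕ ⊕ Fin M × ℕ → K} {C : ℝ}
    (hF : IsMittagLeffler b R x r F c) (hC : ∀ z, ‖F z‖ ≤ C) (i : Fin M) (m : ℕ) :
    ‖c (Sum.inr (i, m))‖ * mlWeight R r (Sum.inr (i, m)) ≤ C := by
  obtain ⟨ρ, hrρ, hρR, hρ⟩ := exists_annulus hrR hsep i
  have hmem : ∀ {t : K}, r i ≤ ‖t‖ → ‖t‖ < ρ → x i + t ∈ holedDisc b R x r :=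
    mem_holedDisc_of_mem_annulus hxb hsep hρR hρ
  have hF' : IsMittagLeffler b R x r
      (fun z => Function.extend Subtype.val F 0 (z : K)) c := by
    convert hF using 2 with z
    exact Subtype.val_injective.extend_apply _ _ z
  obtain ⟨u, hu1, hu2⟩ := hF'.exists_laurent hr hxb hsep hρR hρ
  have hbd : ∀ s ∈ Set.Ioo (r i) ρ, ‖c (Sum.inr (i, m))‖ ≤ C * s ^ (m + 1) := by
    intro s hs
    obtain ⟨y, hy1, hy2⟩ := exists_norm_mem_Ioo (K := K) (hr i) hs.1
    have hyρ : ‖y‖ < ρ := hy2.trans hs.2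
    have h := norm_coeff_mul_zpow_le hp0 hp (y := y) (C := C)
      (fun t ht => hu2 t (ht ▸ hy1.le) (ht ▸ hyρ))
      (fun t ht => by
        have hz := hmem (ht ▸ hy1.le) (ht ▸ hyρ)
        rw [show x i + t = ((⟨_, hz⟩ : holedDisc b R x r) : K) from rfl,
          Subtype.val_injective.extend_apply]
        exact hC _) (-(m + 1))
    have hy0 : 0 < ‖y‖ := (hr i).trans hy1
    have hC0 : 0 ≤ C := (by positivity : (0 : ℝ) ≤ _).trans h
    rw [hu1, zpow_neg, ← Nat.cast_add_one, zpow_natCast, ← div_eq_mul_inv,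
      div_le_iff₀ (pow_pos hy0 _)] at h
    exact h.trans (by gcongr)
  have hlim : Tendsto (fun s : ℝ => C * s ^ (m + 1)) (𝓝[>] (r i)) (𝓝 (C * r i ^ (m + 1))) :=
    Tendsto.mono_left (Continuous.tendsto (by fun_prop) _) nhdsWithin_le_nhds
  have := ge_of_tendsto hlim
    (by filter_upwards [Ioo_mem_nhdsGT hrρ] with s hs using hbd s hs)
  rw [mlWeight, ← div_eq_mul_inv]
  exact (div_le_iff₀ (pow_pos (hr i) _)).mpr this

/-- The coefficients of a Mittag-Leffler expansion are bounded by the supremum norm of the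
function. For the power series part this uses that the function minus its principal parts satisfies
the same bound on the open disc around `b`, which contains no hole. -/
theorem IsMittagLeffler.norm_mul_le (hp0 : 0 < p) (hp : ‖(p : K)‖ < 1) (hR : 0 < R)
    (hr : ∀ i, 0 < r i) (hrR : ∀ i, r i < R) (hxb : ∀ i, ‖x i - b‖ = R)
    (hsep : ∀ i j, i ≠ j → r i < ‖x j - x i‖) {F : holedDisc b R x r → K}
    {c : ℕ ⊕ Fin M × ℕ → K} {C : ℝ} (hF : IsMittagLeffler b R x r F c) (hC : ∀ z, ‖F z‖ ≤ C)
    (j : ℕ ⊕ Fin M × ℕ) : ‖c j‖ * mlWeight R r j ≤ C := by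
  have hinr : ∀ i m, ‖c (Sum.inr (i, m))‖ * mlWeight R r (Sum.inr (i, m)) ≤ C :=
    hF.norm_inr_mul_le hp0 hp hr hrR (fun i => (hxb i).le) hsep hC
  rcases j with m | ⟨i, m⟩
  swap
  · exact hinr i m
  have hmem : ∀ t : K, ‖t‖ < R → b + t ∈ holedDisc b R x r := by
    intro t ht
    refine ⟨by rw [add_sub_cancel_left]; exact ht.le, fun i => ?_⟩
    rw [add_sub_right_comm, add_comm, norm_add_eq_right] <;> rw [norm_sub_rev, hxb i]
    · exact (hrR i).le
    · exact ht
  have hC0 : 0 ≤ C := (norm_nonneg _).trans (hC ⟨_, hmem 0 (by simpa using hR)⟩)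
  -- The power series part is `F` minus the principal parts, so it is bounded by `C` as well.
  have hG : ∀ t : K, ‖t‖ < R → ∃ s, HasSum (fun n => c (Sum.inl n) * t ^ n) s ∧ ‖s‖ ≤ C := by
    intro t ht
    have h := hF.2 ⟨_, hmem t ht⟩
    have h1 : HasSum (fun n => c (Sum.inl n) * t ^ n)
        (∑' n, c (Sum.inl n) * t ^ n) := by
      have := h.summable.comp_injective Sum.inl_injective
      simp only [mlBasis, Function.comp_def, add_sub_cancel_left] at this
      exact this.hasSum
    have h2 : HasSum (fun q => c (Sum.inr q) * mlBasis b x (Sum.inr q) (b + t))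
        (∑' q, c (Sum.inr q) * mlBasis b x (Sum.inr q) (b + t)) :=
      (h.summable.comp_injective Sum.inr_injective).hasSum
    refine ⟨_, h1, ?_⟩
    have h3 := h.unique (HasSum.sum (f := fun j => c j * mlBasis b x j (b + t))
      (by simpa only [mlBasis, Function.comp_def, add_sub_cancel_left] using h1) h2)
    rw [← sub_eq_iff_eq_add] at h3
    rw [← h3]
    refine (norm_sub_le_max _ _).trans (max_le (hC _) (norm_le_of_hasSum hC0 h2 fun q => ?_))
    rw [norm_mul]
    exact (mul_le_mul_of_nonneg_left (norm_mlBasis_le hr (hmem t ht) _) (norm_nonneg _)).trans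
      (hinr q.1 q.2)
  choose! G hG1 hG2 using hG
  have hbd : ∀ s ∈ Set.Ioo 0 R, ‖c (Sum.inl m)‖ * s ^ m ≤ C := by
    intro s hs
    obtain ⟨y, hy1, hy2⟩ := exists_norm_mem_Ioo (K := K) hs.1 hs.2
    have h := norm_coeff_mul_zpow_le hp0 hp (u := fun n : ℤ => if 0 ≤ n then c (Sum.inl n.toNat) else 0)
      (g := G) (y := y) (C := C)
      (fun t ht => hasSum_int_of_hasSum_nat (d := fun n => c (Sum.inl n)) (hG1 t (ht ▸ hy2)))
      (fun t ht => hG2 t (ht ▸ hy2)) (m : ℤ)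
    rw [if_pos (Int.natCast_nonneg m), Int.toNat_natCast, zpow_natCast] at h
    refine le_trans ?_ h
    have := hs.1.le
    gcongr
  have hlim : Tendsto (fun s : ℝ => ‖c (Sum.inl m)‖ * s ^ m) (𝓝[<] R)
      (𝓝 (‖c (Sum.inl m)‖ * R ^ m)) :=
    Tendsto.mono_left (Continuous.tendsto (by fun_prop) _) nhdsWithin_le_nhds
  exact le_of_tendsto hlim (by filter_upwards [Ioo_mem_nhdsLT hR] with s hs using hbd s hs)

/-- A uniform limit of functions with a Mittag-Leffler expansion has a Mittag-Leffler expansion: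
by the coefficient estimate, the coefficients converge uniformly. -/
theorem exists_isMittagLeffler_of_tendstoUniformly (hp0 : 0 < p) (hp : ‖(p : K)‖ < 1)
    (hR : 0 < R) (hr : ∀ i, 0 < r i) (hrR : ∀ i, r i < R) (hxb : ∀ i, ‖x i - b‖ = R)
    (hsep : ∀ i j, i ≠ j → r i < ‖x j - x i‖) {F : ℕ → holedDisc b R x r → K}
    {f : holedDisc b R x r → K} (hF : ∀ k, ∃ c, IsMittagLeffler b R x r (F k) c)
    (hf : ∀ ε > 0, ∃ k₀, ∀ k ≥ k₀, ∀ z, ‖F k z - f z‖ ≤ ε) :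
    ∃ c, IsMittagLeffler b R x r f c := by
  choose c hc using hF
  have hw := mlWeight_pos (r := r) hR hr
  have hcau : ∀ ε > 0, ∃ k₀, ∀ k ≥ k₀, ∀ l ≥ k₀, ∀ j, ‖c k j - c l j‖ * mlWeight R r j ≤ ε := by
    intro ε hε
    obtain ⟨k₀, hk₀⟩ := hf ε hε
    refine ⟨k₀, fun k hk l hl j => ?_⟩
    refine ((hc k).sub hR hr (hc l)).norm_mul_le hp0 hp hR hr hrR hxb hsep (fun z => ?_) j
    rw [Pi.sub_apply, ← sub_sub_sub_cancel_right _ _ (f z)]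
    exact (norm_sub_le_max _ _).trans (max_le (hk₀ k hk z) (hk₀ l hl z))
  have hlim : ∀ j, ∃ l, Tendsto (fun k => c k j) atTop (𝓝 l) := by
    intro j
    refine cauchySeq_tendsto_of_complete (Metric.cauchySeq_iff'.mpr fun ε hε => ?_)
    obtain ⟨k₀, hk₀⟩ := hcau (ε / 2 * mlWeight R r j) (mul_pos (half_pos hε) (hw j))
    refine ⟨k₀, fun k hk => ?_⟩
    rw [dist_eq_norm]
    exact (le_of_mul_le_mul_right (hk₀ k hk k₀ le_rfl j) (hw j)).trans_lt (half_lt_self hε)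
  choose d hd using hlim
  have hdist : ∀ ε > 0, ∃ k₀, ∀ k ≥ k₀, ∀ j, ‖c k j - d j‖ * mlWeight R r j ≤ ε := by
    intro ε hε
    obtain ⟨k₀, hk₀⟩ := hcau ε hε
    refine ⟨k₀, fun k hk j => ?_⟩
    refine le_of_tendsto (((tendsto_const_nhds.sub (hd j)).norm).mul_const _) ?_
    filter_upwards [eventually_ge_atTop k₀] with l hl using hk₀ k hk l hl j
  have hd0 : Tendsto (fun j => ‖d j‖ * mlWeight R r j) cofinite (𝓝 0) := by
    rw [Metric.tendsto_nhds]
    intro ε hε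
    obtain ⟨k, hk⟩ := hdist (ε / 2) (half_pos hε)
    filter_upwards [Metric.tendsto_nhds.mp (hc k).1 (ε / 2) (half_pos hε)] with j hj
    have hj' : ‖c k j‖ * mlWeight R r j < ε / 2 := by
      rw [dist_zero_right, Real.norm_eq_abs] at hj
      exact (le_abs_self _).trans_lt hj
    rw [dist_zero_right, Real.norm_of_nonneg (mul_nonneg (norm_nonneg _) (hw j).le)]
    calc ‖d j‖ * mlWeight R r j ≤ (‖c k j‖ + ‖c k j - d j‖) * mlWeight R r j := by
          refine mul_le_mul_of_nonneg_right ?_ (hw j).le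
          calc ‖d j‖ = ‖c k j - (c k j - d j)‖ := by rw [sub_sub_cancel]
            _ ≤ _ := norm_sub_le _ _
      _ < ε := by
          have := hk k le_rfl j
          rw [add_mul]
          linarith
  refine ⟨d, hd0, fun z => ?_⟩
  have hterm : ∀ (e : K) j, ‖e * mlBasis b x j z‖ ≤ ‖e‖ * mlWeight R r j := fun e j => by
    rw [norm_mul]
    exact mul_le_mul_of_nonneg_left (norm_mlBasis_le hr z.2 j) (norm_nonneg _)
  have hsum : Summable fun j => d j * mlBasis b x j z :=
    NonarchimedeanAddGroup.summable_of_tendsto_cofinite_zero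
      (squeeze_zero_norm (fun j => hterm _ j) hd0)
  have hS := hsum.hasSum
  suffices h : ∑' j, d j * mlBasis b x j z = f z from h ▸ hS
  rw [← sub_eq_zero, ← norm_le_zero_iff]
  refine le_of_forall_pos_le_add fun ε hε => ?_
  obtain ⟨k₀, hk₀⟩ := hdist ε hε
  obtain ⟨k₁, hk₁⟩ := hf ε hε
  have h1 := hk₁ (max k₀ k₁) (le_max_right _ _) z
  have h2 : ‖F (max k₀ k₁) z - ∑' j, d j * mlBasis b x j z‖ ≤ ε := by
    refine norm_le_of_hasSum hε.le (((hc _).2 z).sub hS) fun j => ?_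
    rw [← sub_mul]
    exact (hterm _ j).trans (hk₀ _ (le_max_left _ _) j)
  rw [zero_add, ← sub_sub_sub_cancel_left _ _ (F (max k₀ k₁) z)]
  exact (norm_sub_le_max _ _).trans (max_le h1 h2)

end Estimate

/-! ### Powers of exponent `p ^ n` -/

section Frobenius

variable {K : Type*} [NormedField K] [IsUltrametricDist K] {p : ℕ}

theorem norm_add_pow_prime_sub_le (hpp : p.Prime) {w h : K} (hw : ‖w‖ ≤ 1) (hh : ‖h‖ ≤ 1) :
    ‖(w + h) ^ p - w ^ p - h ^ p‖ ≤ ‖(p : K)‖ * ‖h‖ := by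
  obtain ⟨q, rfl⟩ : ∃ q, p = q + 1 := ⟨p - 1, (Nat.succ_pred_prime hpp).symm⟩
  rw [add_pow, Finset.sum_range_succ, Finset.sum_range_succ']
  simp only [Nat.choose_self, Nat.choose_zero_right, Nat.sub_self, pow_zero, one_mul, mul_one,
    Nat.cast_one, Nat.sub_zero]
  rw [add_sub_cancel_right, add_sub_cancel_right]
  refine IsUltrametricDist.norm_sum_le_of_forall_le_of_nonneg (by positivity) fun i hi => ?_
  rw [Finset.mem_range] at hi
  obtain ⟨k, hk⟩ := hpp.dvd_choose_self (Nat.succ_ne_zero i) (Nat.succ_lt_succ hi)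
  rw [hk, norm_mul, norm_mul, Nat.cast_mul, norm_mul, norm_pow, norm_pow, mul_comm]
  have h1 : ‖w‖ ^ (i + 1) ≤ 1 := pow_le_one₀ (norm_nonneg _) hw
  have h2 : ‖h‖ ^ (q + 1 - (i + 1)) ≤ ‖h‖ := pow_le_of_le_one (norm_nonneg _) hh (by omega)
  have h3 := IsUltrametricDist.norm_natCast_le_one K k
  refine mul_le_mul (mul_le_of_le_one_right (norm_nonneg _) h3) ?_ (by positivity) (norm_nonneg _)
  exact (mul_le_of_le_one_left (by positivity) h1).trans h2

/-- If `u` and `w` lie in the same residue class, then `u ^ p ^ n - w ^ p ^ n` tends to zero. -/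
theorem tendsto_pow_prime_pow_sub (hpp : p.Prime) (hp : ‖(p : K)‖ < 1) {u w : K} (hu : ‖u‖ ≤ 1)
    (huw : ‖u - w‖ < 1) : Tendsto (fun n : ℕ => u ^ p ^ n - w ^ p ^ n) atTop (𝓝 0) := by
  have hw : ‖w‖ ≤ 1 := by
    rw [← sub_sub_cancel u w]
    exact (norm_sub_le_max _ _).trans (max_le hu huw.le)
  set θ := max ‖(p : K)‖ ‖u - w‖ with hθ
  have hθ0 : 0 ≤ θ := le_max_of_le_left (norm_nonneg _)
  have hθ1 : θ < 1 := max_lt hp huw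
  have key : ∀ n, ‖u ^ p ^ n - w ^ p ^ n‖ ≤ θ ^ n * θ := by
    intro n
    induction n with
    | zero => simp [hθ]
    | succ n ih =>
      set d := u ^ p ^ n - w ^ p ^ n with hd
      have hdθ : ‖d‖ ≤ θ := ih.trans (mul_le_of_le_one_left hθ0 (pow_le_one₀ hθ0 hθ1.le))
      have h1 := norm_add_pow_prime_sub_le hpp (w := w ^ p ^ n) (h := d)
        (by rw [norm_pow]; exact pow_le_one₀ (norm_nonneg _) hw) (hdθ.trans hθ1.le)
      have h2 : ‖d ^ p‖ ≤ θ * ‖d‖ := by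
        rw [norm_pow]
        calc ‖d‖ ^ p ≤ ‖d‖ ^ 2 :=
              pow_le_pow_of_le_one (norm_nonneg _) (hdθ.trans hθ1.le) hpp.two_le
          _ = ‖d‖ * ‖d‖ := sq _
          _ ≤ θ * ‖d‖ := by gcongr
      have h3 : u ^ p ^ (n + 1) - w ^ p ^ (n + 1) =
          ((w ^ p ^ n + d) ^ p - (w ^ p ^ n) ^ p - d ^ p) + d ^ p := by
        rw [hd, add_sub_cancel, ← pow_mul, ← pow_mul, ← pow_succ]
        ring
      rw [h3]
      calc _ ≤ θ * ‖d‖ := (IsUltrametricDist.norm_add_le_max _ _).trans (max_le (h1.trans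
            (mul_le_mul_of_nonneg_right (le_max_left _ _) (norm_nonneg _))) h2)
        _ ≤ θ * (θ ^ n * θ) := by gcongr
        _ = θ ^ (n + 1) * θ := by ring
  refine squeeze_zero_norm key ?_
  simpa using (tendsto_pow_atTop_nhds_zero_of_lt_one hθ0 hθ1).mul_const θ

theorem norm_one_sub_pow_prime_pow_eq_one (hpp : p.Prime) (hp : ‖(p : K)‖ < 1) {u : K}
    (hu : ‖u‖ ≤ 1) (h : ‖1 - u‖ = 1) (n : ℕ) : ‖1 - u ^ p ^ n‖ = 1 := by
  induction n with
  | zero => simpa using h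
  | succ n ih =>
    have hu' : ‖u ^ p ^ n‖ ≤ 1 := by
      rw [norm_pow]
      exact pow_le_one₀ (norm_nonneg _) hu
    have h1 := norm_add_pow_prime_sub_le hpp hu' ih.le
    rw [add_sub_cancel, one_pow, ih, mul_one, ← pow_mul, ← pow_succ] at h1
    have h2 : ‖(1 - u ^ p ^ n) ^ p‖ = 1 := by rw [norm_pow, ih, one_pow]
    rw [← sub_add_cancel (1 - u ^ p ^ (n + 1)) ((1 - u ^ p ^ n) ^ p), norm_add_eq_right, h2]
    rw [h2]
    exact h1.trans_lt hp

theorem norm_sub_one_lt_one_of_pow_prime_pow (hpp : p.Prime) (hp : ‖(p : K)‖ < 1) {u : K}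
    (hu : ‖u‖ ≤ 1) {n : ℕ} (h : ‖u ^ p ^ n - 1‖ < 1) : ‖u - 1‖ < 1 := by
  refine lt_of_le_of_ne ((norm_sub_le_max _ _).trans (max_le hu norm_one.le)) fun h1 => h.ne ?_
  rw [norm_sub_rev] at h1 ⊢
  exact norm_one_sub_pow_prime_pow_eq_one hpp hp hu h1 n

theorem tendsto_choose_prime_pow [CharZero K] (hp : ‖(p : K)‖ < 1) (j : ℕ) :
    Tendsto (fun n : ℕ => (((p ^ n).choose (j + 1) : ℕ) : K)) atTop (𝓝 0) := by
  have h0 := (tendsto_pow_atTop_nhds_zero_of_norm_lt_one hp).norm.mul_const ‖((j + 1 : ℕ) : K)‖⁻¹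
  rw [norm_zero, zero_mul] at h0
  refine squeeze_zero_norm (fun n => ?_) h0
  have hj : 0 < ‖((j + 1 : ℕ) : K)‖ := norm_pos_iff.mpr (Nat.cast_ne_zero.mpr j.succ_ne_zero)
  rw [← div_eq_mul_inv, le_div_iff₀ hj, ← norm_mul, ← Nat.cast_mul]
  rcases Nat.eq_zero_or_pos (p ^ n) with h | h
  · simp [h]
  · obtain ⟨q, hq⟩ : ∃ q, p ^ n = q + 1 := ⟨p ^ n - 1, by omega⟩
    have h1 := Nat.add_one_mul_choose_eq q j
    rw [← hq] at h1
    rw [← h1, Nat.cast_mul, norm_mul, Nat.cast_pow]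
    exact mul_le_of_le_one_right (norm_nonneg _) (IsUltrametricDist.norm_natCast_le_one K _)

end Frobenius

/-! ### Arc sums of the basis functions -/

section Arc

variable {K : Type*} [NormedField K] [IsAlgClosed K] [CharZero K]

theorem rootMean_mul_sub_pow {N : ℕ} (hN : 0 < N) (u : K) (k : ℕ) :
    rootMean N (fun ζ : K => ζ * (ζ - u) ^ k) = ∑ i ∈ Finset.range (k + 1),
      ((-u) ^ (k - i) * (k.choose i : K)) * if N ∣ i + 1 then 1 else 0 := by
  have : (fun ζ : K => ζ * (ζ - u) ^ k) = fun ζ => ∑ i ∈ Finset.range (k + 1),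
      ((-u) ^ (k - i) * (k.choose i : K)) * ζ ^ ((i + 1 : ℕ) : ℤ) := by
    funext ζ
    rw [sub_eq_add_neg, add_pow, Finset.mul_sum]
    refine Finset.sum_congr rfl fun i _ => ?_
    rw [zpow_natCast]
    ring
  rw [this, rootMean_sum]
  refine Finset.sum_congr rfl fun i _ => ?_
  rw [rootMean_const_mul, rootMean_zpow hN]
  simp only [Int.natCast_dvd_natCast]

theorem rootMean_mul_sub_pow_eq_zero {N k : ℕ} (hk : k + 1 < N) (u : K) :
    rootMean N (fun ζ : K => ζ * (ζ - u) ^ k) = 0 := by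
  rw [rootMean_mul_sub_pow (by omega)]
  refine Finset.sum_eq_zero fun i hi => ?_
  rw [Finset.mem_range] at hi
  rw [if_neg fun h => ?_, mul_zero]
  have := Nat.le_of_dvd i.succ_pos h
  omega

theorem rootMean_mul_sub_pow_pred (N : ℕ) (u : K) :
    rootMean (N + 1) (fun ζ : K => ζ * (ζ - u) ^ N) = 1 := by
  rw [rootMean_mul_sub_pow N.succ_pos, Finset.sum_range_succ, Finset.sum_eq_zero fun i hi => ?_]
  · simp
  · rw [Finset.mem_range] at hi
    rw [if_neg fun h => ?_, mul_zero]
    have := Nat.le_of_dvd i.succ_pos h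
    omega

theorem norm_rootMean_mul_sub_pow_le [IsUltrametricDist K] {N : ℕ} (hN : 0 < N) {u : K}
    (hu : ‖u‖ ≤ 1) (k : ℕ) : ‖rootMean N (fun ζ : K => ζ * (ζ - u) ^ k)‖ ≤ 1 := by
  rw [rootMean_mul_sub_pow hN]
  refine IsUltrametricDist.norm_sum_le_of_forall_le_of_nonneg zero_le_one fun i _ => ?_
  have h1 : ‖(-u) ^ (k - i)‖ ≤ 1 := by
    rw [norm_pow, norm_neg]
    exact pow_le_one₀ (norm_nonneg _) hu
  have h2 := IsUltrametricDist.norm_natCast_le_one K (k.choose i)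
  split_ifs
  · rw [mul_one, norm_mul]
    exact mul_le_one₀ h1 (norm_nonneg _) h2
  · simp

/-- The mean of `ζ / (ζ - u) ^ (m + 1)` over the `N`-th roots of unity. -/
noncomputable def poleMean (N : ℕ) (u : K) (m : ℕ) : K :=
  rootMean N fun ζ : K => ζ * ((ζ - u) ^ (m + 1))⁻¹

/-- The recursion for the means `poleMean N u m`. It results from the expansion of
`ζ ^ N = ((ζ - u) + u) ^ N` in `ζ / (ζ - u) ^ (m + 1) = ζ ^ N * ζ / (ζ - u) ^ (m + 1)`: the terms
that are polynomials in `ζ` have mean zero, except for the leading one if `m = 0`. -/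
theorem poleMean_eq {N : ℕ} (hN : 0 < N) {u : K} (hu : u ^ N ≠ 1) (m : ℕ) :
    poleMean N u m = (∑ j ∈ Finset.range (m + 1),
      ((N.choose j : K) * u ^ (N - j)) * poleMean N u (m - j)) + if m = 0 then 1 else 0 := by
  have h1 : poleMean N u m = rootMean N fun ζ : K => ∑ j ∈ Finset.range (m + 1 + N),
      ((N.choose j : K) * u ^ (N - j)) * (ζ * ((ζ - u) ^ j * ((ζ - u) ^ (m + 1))⁻¹)) := by
    refine rootMean_congr hN fun ζ hζ => ?_
    have h2 : ∑ j ∈ Finset.range (m + 1 + N), (ζ - u) ^ j * u ^ (N - j) * (N.choose j : K) = 1 := by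
      rw [← hζ]
      conv_rhs => rw [← sub_add_cancel ζ u, add_pow]
      refine (Finset.sum_subset (Finset.range_mono (by omega)) fun j _ hj => ?_).symm
      rw [Finset.mem_range, not_lt, Nat.succ_le_iff] at hj
      rw [Nat.choose_eq_zero_of_lt hj, Nat.cast_zero, mul_zero]
    calc _ = (∑ j ∈ Finset.range (m + 1 + N), (ζ - u) ^ j * u ^ (N - j) * (N.choose j : K)) *
          (ζ * ((ζ - u) ^ (m + 1))⁻¹) := by rw [h2, one_mul]
      _ = _ := by
        rw [Finset.sum_mul]
        exact Finset.sum_congr rfl fun j _ => by ring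
  have hne : ∀ ζ : K, ζ ^ N = 1 → ζ - u ≠ 0 := fun ζ hζ h => hu (sub_eq_zero.mp h ▸ hζ)
  rw [h1, rootMean_sum, Finset.sum_range_add]
  congr 1
  · refine Finset.sum_congr rfl fun j hj => ?_
    rw [rootMean_const_mul, poleMean]
    congr 1
    refine rootMean_congr hN fun ζ hζ => ?_
    have := hne ζ hζ
    rw [Finset.mem_range, Nat.lt_succ_iff] at hj
    have h3 : (ζ - u) ^ (m + 1) = (ζ - u) ^ j * (ζ - u) ^ (m - j + 1) := by
      rw [← pow_add]
      congr 1
      omega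
    rw [h3, mul_inv, mul_inv_cancel_left₀ (pow_ne_zero _ this)]
  · have h4 : ∀ k, rootMean N (fun ζ : K => ((N.choose (m + 1 + k) : K) * u ^ (N - (m + 1 + k))) *
        (ζ * ((ζ - u) ^ (m + 1 + k) * ((ζ - u) ^ (m + 1))⁻¹))) =
        ((N.choose (m + 1 + k) : K) * u ^ (N - (m + 1 + k))) *
          rootMean N fun ζ : K => ζ * (ζ - u) ^ k := by
      intro k
      rw [rootMean_const_mul]
      congr 1
      refine rootMean_congr hN fun ζ hζ => ?_
      rw [pow_add, mul_right_comm ((ζ - u) ^ (m + 1)), mul_inv_cancel₀ (pow_ne_zero _ (hne ζ hζ)),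
        one_mul]
    simp only [h4]
    obtain ⟨n, rfl⟩ : ∃ n, N = n + 1 := ⟨N - 1, by omega⟩
    rw [Finset.sum_range_succ, Finset.sum_eq_zero fun k hk => ?_, rootMean_mul_sub_pow_pred]
    · split_ifs with hm
      · subst hm
        simp [add_comm 1 n]
      · rw [Nat.choose_eq_zero_of_lt (by omega)]
        simp
    · rw [Finset.mem_range] at hk
      rw [rootMean_mul_sub_pow_eq_zero (by omega), mul_zero]

theorem poleMean_zero {N : ℕ} (hN : 0 < N) {u : K} (hu : u ^ N ≠ 1) :
    poleMean N u 0 = 1 / (1 - u ^ N) := by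
  have h := poleMean_eq hN hu 0
  rw [zero_add, Finset.sum_range_one, if_pos rfl, Nat.choose_zero_right, Nat.cast_one, one_mul,
    Nat.sub_zero, Nat.sub_zero] at h
  rw [eq_div_iff (sub_ne_zero.mpr hu.symm), mul_sub, mul_one, mul_comm]
  exact sub_eq_of_eq_add' h

theorem poleMean_succ_mul {N : ℕ} (hN : 0 < N) {u : K} (hu : u ^ N ≠ 1) (m : ℕ) :
    poleMean N u (m + 1) * (1 - u ^ N) = ∑ j ∈ Finset.range (m + 1),
      ((N.choose (j + 1) : K) * u ^ (N - (j + 1))) * poleMean N u (m - j) := by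
  have h := poleMean_eq hN hu (m + 1)
  rw [Finset.sum_range_succ', if_neg (Nat.succ_ne_zero m), add_zero, Nat.choose_zero_right,
    Nat.cast_one, one_mul, Nat.sub_zero, Nat.sub_zero] at h
  simp only [Nat.add_sub_add_right] at h
  rw [mul_sub, mul_one, mul_comm _ (u ^ N)]
  exact sub_eq_of_eq_add h

theorem norm_poleMean_le [IsUltrametricDist K] {N : ℕ} (hN : 0 < N) {u : K} (hu1 : ‖u‖ ≤ 1)
    (hu : ‖1 - u ^ N‖ = 1) (m : ℕ) : ‖poleMean N u m‖ ≤ 1 := by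
  have hu' : u ^ N ≠ 1 := fun h => by simp [h] at hu
  induction m using Nat.strong_induction_on with
  | _ m ih =>
    rcases m with _ | m
    · rw [poleMean_zero hN hu', norm_div, hu, norm_one, div_one]
    · rw [← mul_one ‖_‖, ← hu, ← norm_mul, poleMean_succ_mul hN hu', hu]
      refine IsUltrametricDist.norm_sum_le_of_forall_le_of_nonneg zero_le_one fun j _ => ?_
      rw [norm_mul, norm_mul, norm_pow]
      exact mul_le_one₀ (mul_le_one₀ (IsUltrametricDist.norm_natCast_le_one K _) (by positivity)
        (pow_le_one₀ (norm_nonneg _) hu1)) (norm_nonneg _) (ih _ (by omega))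

theorem tendsto_poleMean_succ [IsUltrametricDist K] {p : ℕ} (hpp : p.Prime) (hp : ‖(p : K)‖ < 1)
    {u : K} (hu : ‖u‖ ≤ 1) (hu1 : ‖1 - u‖ = 1) (m : ℕ) :
    Tendsto (fun n : ℕ => poleMean (p ^ n) u (m + 1)) atTop (𝓝 0) := by
  have hunit := norm_one_sub_pow_prime_pow_eq_one hpp hp hu hu1
  have h0 : Tendsto (fun n : ℕ => ∑ j ∈ Finset.range (m + 1),
      ‖(((p ^ n).choose (j + 1) : ℕ) : K)‖) atTop (𝓝 0) := by
    rw [← Finset.sum_const_zero (s := Finset.range (m + 1))]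
    refine tendsto_finsetSum _ fun j _ => ?_
    simpa using (tendsto_choose_prime_pow hp j).norm
  refine squeeze_zero_norm (fun n => ?_) h0
  have hN : 0 < p ^ n := pow_pos hpp.pos n
  have hne : u ^ p ^ n ≠ 1 := fun h => by simpa [h] using hunit n
  rw [← mul_one ‖_‖, ← hunit n, ← norm_mul, poleMean_succ_mul hN hne]
  refine (norm_sum_le _ _).trans (Finset.sum_le_sum fun j _ => ?_)
  rw [norm_mul, norm_mul, mul_assoc, norm_pow]
  refine mul_le_of_le_one_right (norm_nonneg _) (mul_le_one₀
    (pow_le_one₀ (norm_nonneg _) hu) (norm_nonneg _) (norm_poleMean_le hN hu (hunit n) _))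

/-- The arc sums, for the centre `a` of the arc around `b`, of a function with a Mittag-Leffler
expansion converge along every sequence of exponents on which the powers `u ^ p ^ n` of the points
`u = (a - x i) / (a - b)` converge. -/
theorem IsMittagLeffler.tendsto_rootMean [IsUltrametricDist K] {p M : ℕ} (hpp : p.Prime)
    (hp : ‖(p : K)‖ < 1) {a b : K} {R : ℝ} {x : Fin M → K} {r : Fin M → ℝ} (hR : 0 < R)
    (hr : ∀ i, 0 < r i) (hrR : ∀ i, r i < R) (hba : ‖b - a‖ = R) (hbx : ∀ i, ‖b - x i‖ = R)
    {f : K → K} {c : ℕ ⊕ Fin M × ℕ → K} (hf : IsMittagLeffler b R x r (fun z => f z) c)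
    {φ : ℕ → ℕ} (hφ : Tendsto φ atTop atTop) {v : Fin M → K}
    (hv : ∀ i, Tendsto (fun k => ((a - x i) / (a - b)) ^ p ^ φ k) atTop (𝓝 (v i)))
    (hv1 : ∀ i, 1 - v i ≠ 0) :
    Tendsto (fun k => rootMean (p ^ φ k) fun ζ => (b - a) * ζ * f (a + (b - a) * ζ)) atTop
      (𝓝 (∑ i, 1 / (1 - v i) * c (Sum.inr (i, 0)))) := by
  have hba0 : b - a ≠ 0 := norm_pos_iff.mp (hba ▸ hR)
  have hab0 : a - b ≠ 0 := by rwa [← neg_sub, neg_ne_zero]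
  set u : Fin M → K := fun i => (a - x i) / (a - b) with hu
  have hub : ∀ i, (b - a) * u i = x i - a := fun i => by
    simp only [hu]
    field_simp
    ring
  have hu1 : ∀ i, ‖1 - u i‖ = 1 := fun i => by
    have : 1 - u i = (b - x i) / (b - a) := by
      rw [eq_div_iff hba0, mul_comm, mul_sub, hub]
      ring
    rw [this, norm_div, hbx, hba, div_self hR.ne']
  have hule : ∀ i, ‖u i‖ ≤ 1 := fun i => by
    rw [← sub_sub_cancel 1 (u i)]
    exact (norm_sub_le_max _ _).trans (max_le norm_one.le (hu1 i).le)
  have hN : ∀ k, 0 < p ^ φ k := fun k => pow_pos hpp.pos _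
  have hunit : ∀ i k, ‖1 - u i ^ p ^ φ k‖ = 1 := fun i k =>
    norm_one_sub_pow_prime_pow_eq_one hpp hp (hule i) (hu1 i) _
  have hinl : ∀ m k, rootMean (p ^ φ k)
      (fun ζ => (b - a) * ζ * mlBasis b x (Sum.inl m) (a + (b - a) * ζ)) =
      (b - a) ^ (m + 1) * rootMean (p ^ φ k) fun ζ => ζ * (ζ - 1) ^ m := fun m k => by
    rw [← rootMean_const_mul]
    congr 1
    funext ζ
    rw [mlBasis, show a + (b - a) * ζ - b = (b - a) * (ζ - 1) by ring, mul_pow]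
    ring
  have hinr : ∀ i m k, rootMean (p ^ φ k)
      (fun ζ => (b - a) * ζ * mlBasis b x (Sum.inr (i, m)) (a + (b - a) * ζ)) =
      (b - a) * ((b - a) ^ (m + 1))⁻¹ * poleMean (p ^ φ k) (u i) m := fun i m k => by
    rw [poleMean, ← rootMean_const_mul]
    congr 1
    funext ζ
    have : a + (b - a) * ζ - x i = (b - a) * (ζ - u i) := by
      rw [mul_sub, hub]
      ring
    rw [mlBasis, this, mul_pow, mul_inv]
    ring
  have hmem : ∀ k (ζ : K), ζ ^ p ^ φ k = 1 → a + (b - a) * ζ ∈ holedDisc b R x r := by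
    intro k ζ hζ
    have h1 : ‖ζ - 1‖ < 1 := norm_sub_one_lt_one_of_pow_prime_pow hpp hp
      (norm_eq_one_of_pow_eq_one (hN k) hζ).le (n := φ k) (by simp [hζ])
    have h2 : ‖(b - a) * (ζ - 1)‖ < R := by
      rw [norm_mul, hba]
      exact mul_lt_of_lt_one_right hR h1
    refine ⟨?_, fun i => ?_⟩
    · rw [show a + (b - a) * ζ - b = (b - a) * (ζ - 1) by ring]
      exact h2.le
    · rw [show a + (b - a) * ζ - x i = (b - a) * (ζ - 1) + (b - x i) by ring,
        norm_add_eq_right (by rwa [hbx]), hbx]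
      exact (hrR i).le
  have hB : Tendsto (fun j => R * (‖c j‖ * mlWeight R r j)) cofinite (𝓝 0) := by
    simpa using hf.1.const_mul R
  refine tendsto_of_hasSum_of_le hB (F := fun j k => c j * rootMean (p ^ φ k) fun ζ =>
    (b - a) * ζ * mlBasis b x j (a + (b - a) * ζ))
    (l := Sum.elim 0 fun q => if q.2 = 0 then 1 / (1 - v q.1) * c (Sum.inr q) else 0)
    (fun j k => ?_) (fun k => ?_) (fun j => ?_) ?_
  · -- The arc sums of the basis functions are bounded by their weights.
    suffices h : ‖rootMean (p ^ φ k) fun ζ => (b - a) * ζ * mlBasis b x j (a + (b - a) * ζ)‖ ≤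
        R * mlWeight R r j by
      rw [norm_mul, mul_left_comm]
      exact mul_le_mul_of_nonneg_left h (norm_nonneg _)
    rcases j with m | ⟨i, m⟩
    · rw [hinl, norm_mul, norm_pow, hba, mlWeight, pow_succ', mul_assoc]
      refine mul_le_mul_of_nonneg_left (mul_le_of_le_one_right (by positivity) ?_) hR.le
      exact norm_rootMean_mul_sub_pow_le (hN k) norm_one.le m
    · rw [hinr, norm_mul, norm_mul, norm_inv, norm_pow, hba, mlWeight]
      have h1 : (R ^ (m + 1))⁻¹ ≤ (r i ^ (m + 1))⁻¹ :=
        inv_anti₀ (pow_pos (hr i) _) (pow_le_pow_left₀ (hr i).le (hrR i).le _)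
      have h2 := norm_poleMean_le (hN k) (hule i) (hunit i k) m
      have h3 := hr i
      calc _ ≤ R * (r i ^ (m + 1))⁻¹ * 1 := by gcongr
        _ = _ := mul_one _
  · have h := hasSum_rootMean (hN k) (g := fun j ζ => c j * ((b - a) * ζ *
      mlBasis b x j (a + (b - a) * ζ))) (f := fun ζ => (b - a) * ζ * f (a + (b - a) * ζ))
      fun ζ hζ => ((hf.2 ⟨_, hmem k ζ hζ⟩).mul_left ((b - a) * ζ)).congr_fun fun j => by ring
    simpa only [rootMean_const_mul] using h
  · rcases j with m | ⟨i, m⟩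
    · refine tendsto_const_nhds.congr' ?_
      filter_upwards [hφ.eventually_gt_atTop (m + 1)] with k hk
      rw [hinl, rootMean_mul_sub_pow_eq_zero (hk.trans (Nat.lt_pow_self hpp.one_lt)), mul_zero,
        mul_zero]
      rfl
    · simp only [hinr, Sum.elim_inr]
      rcases m with _ | m
      · have h1 : Tendsto (fun k => 1 / (1 - u i ^ p ^ φ k)) atTop (𝓝 (1 / (1 - v i))) :=
          tendsto_const_nhds.div (tendsto_const_nhds.sub (hv i)) (hv1 i)
        rw [if_pos rfl]
        refine (h1.mul_const (c (Sum.inr (i, 0)))).congr fun k => ?_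
        rw [poleMean_zero (hN k) fun h => by simpa [h] using hunit i k, zero_add, pow_one,
          mul_inv_cancel₀ hba0, one_mul, mul_comm]
      · rw [if_neg (Nat.succ_ne_zero m), ← mul_zero (c (Sum.inr (i, m + 1))),
          ← mul_zero ((b - a) * ((b - a) ^ (m + 1 + 1))⁻¹)]
        exact (((tendsto_poleMean_succ hpp hp (hule i) (hu1 i) m).comp hφ).const_mul _).const_mul _
  · rw [← zero_add (∑ i, _)]
    refine HasSum.sum hasSum_zero ?_
    have hinj : Function.Injective fun i : Fin M => (i, 0) := fun i i' h => congrArg Prod.fst h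
    refine (hinj.hasSum_iff ?_).mp ?_
    · rintro ⟨i, m⟩ h
      have : m ≠ 0 := fun hm => h ⟨i, by rw [hm]⟩
      simp [this]
    · exact hasSum_fintype _

end Arc

/-! ### The Teichmüller character -/

section Teichmuller

variable {p : ℕ} [Fact p.Prime]

/-- An integral element of an algebraic closure of `ℚ_[p]` lies in a finite `ℤ_[p]`-algebra, so
that two of its powers are congruent modulo `p`. -/
theorem exists_norm_pow_sub_one_lt_one_of_algebraic (y : PadicAlgCl p) (hy : ‖y‖ = 1) :
    ∃ k, 0 < k ∧ ‖y ^ k - 1‖ < 1 := by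
  have hyint : IsIntegral ℚ_[p] y := Algebra.IsIntegral.isIntegral y
  have hcoeff : ∀ n, ‖(minpoly ℚ_[p] y).coeff n‖ ≤ 1 := by
    refine (spectralValue_le_one_iff (minpoly.monic hyint)).mp ?_
    change spectralNorm ℚ_[p] (PadicAlgCl p) y ≤ 1
    rw [PadicAlgCl.spectralNorm_eq, hy]
  have hlift : minpoly ℚ_[p] y ∈ Polynomial.lifts (PadicInt.Coe.ringHom (p := p)) :=
    (Polynomial.lifts_iff_coeff_lifts _).mpr fun n => ⟨⟨_, hcoeff n⟩, rfl⟩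
  obtain ⟨Q, hQ, -, hQm⟩ :=
    Polynomial.lifts_and_natDegree_eq_and_monic hlift (minpoly.monic hyint)
  set e : Polynomial ℤ_[p] → PadicAlgCl p := fun P =>
    Polynomial.aeval y (P.map (PadicInt.Coe.ringHom (p := p))) with he
  have hmod : ∀ P, e (P %ₘ Q) = e P := fun P => by
    simp only [he]
    conv_rhs => rw [← Polynomial.modByMonic_add_div P Q]
    rw [Polynomial.map_add, Polynomial.map_mul, hQ, map_add, map_mul, minpoly.aeval, zero_mul,
      add_zero]
  -- Pigeonhole principle for the remainders of `X ^ k` modulo `Q` and `p`.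
  obtain ⟨k, l, hkl, hcongr⟩ := Finite.exists_ne_map_eq_of_infinite
    (fun (k : ℕ) (i : Fin Q.natDegree) =>
      PadicInt.toZMod (((Polynomial.X : Polynomial ℤ_[p]) ^ k %ₘ Q).coeff i))
  have hsub : ‖y ^ k - y ^ l‖ < 1 := by
    set T := (Polynomial.X : Polynomial ℤ_[p]) ^ k %ₘ Q - Polynomial.X ^ l %ₘ Q with hT
    have h1 : y ^ k - y ^ l = e T := by
      have h2 : ∀ n : ℕ, e (Polynomial.X ^ n) = y ^ n := fun n => by simp [he]
      rw [← h2, ← h2, ← hmod (Polynomial.X ^ k), ← hmod (Polynomial.X ^ l)]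
      simp only [he, hT, Polynomial.map_sub, map_sub]
    have hTc : ∀ n, ‖T.coeff n‖ < 1 := by
      intro n
      by_cases hn : n < Q.natDegree
      · rw [← PadicInt.mem_nonunits, ← IsLocalRing.mem_maximalIdeal, ← PadicInt.ker_toZMod,
          RingHom.mem_ker, hT, Polynomial.coeff_sub, map_sub, sub_eq_zero]
        exact congrFun hcongr ⟨n, hn⟩
      · rw [Polynomial.coeff_eq_zero_of_degree_lt, norm_zero]
        · exact zero_lt_one
        · have hd : T.degree < Q.degree :=
            (Polynomial.degree_sub_le _ _).trans_lt
              (max_lt (Polynomial.degree_modByMonic_lt _ hQm)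
                (Polynomial.degree_modByMonic_lt _ hQm))
          rw [Polynomial.degree_eq_natDegree hQm.ne_zero] at hd
          exact hd.trans_le (Nat.cast_le.mpr (not_lt.mp hn))
    have hTp : ∀ n, ‖T.coeff n‖ ≤ (p : ℝ)⁻¹ := fun n => by
      have := (PadicInt.norm_lt_one_iff_dvd _).mp (hTc n)
      have := (PadicInt.norm_le_pow_iff_mem_span_pow (T.coeff n) 1).mpr
        (by rw [pow_one]; exact Ideal.mem_span_singleton.mpr this)
      simpa using this
    have hp1 : (p : ℝ)⁻¹ < 1 := inv_lt_one_of_one_lt₀ (by exact_mod_cast (Fact.out : p.Prime).one_lt)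
    rw [h1]
    refine lt_of_le_of_lt ?_ hp1
    simp only [he]
    rw [Polynomial.aeval_eq_sum_range]
    refine IsUltrametricDist.norm_sum_le_of_forall_le_of_nonneg (by positivity) fun n _ => ?_
    rw [norm_smul, norm_pow, hy, one_pow, mul_one, Polynomial.coeff_map]
    exact hTp n
  have key : ∀ k l : ℕ, k < l → ‖y ^ k - y ^ l‖ < 1 → ∃ k, 0 < k ∧ ‖y ^ k - 1‖ < 1 := by
    intro k l hkl h
    refine ⟨l - k, Nat.sub_pos_of_lt hkl, ?_⟩
    have h1 : y ^ k - y ^ l = -(y ^ k * (y ^ (l - k) - 1)) := by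
      rw [mul_sub, ← pow_add, Nat.add_sub_cancel' hkl.le]
      ring
    rwa [h1, norm_neg, norm_mul, norm_pow, hy, one_pow, one_mul] at h
  rcases hkl.lt_or_gt with h | h
  · exact key k l h hsub
  · exact key l k h (by rwa [norm_sub_rev])

theorem norm_natCast_prime_lt_one : ‖((p : ℕ) : ℂ_[p])‖ < 1 := by
  have h := PadicComplex.norm_extends' p (p : ℚ_[p])
  rw [Padic.norm_p] at h
  have h1 : algebraMap ℚ_[p] ℂ_[p] (p : ℚ_[p]) = (p : ℂ_[p]) := map_natCast _ p
  rw [← h1]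
  refine h.trans_lt ?_
  exact inv_lt_one_of_one_lt₀ (by exact_mod_cast (Fact.out : p.Prime).one_lt)

theorem norm_pow_sub_pow_lt_one {K : Type*} [NormedField K] [IsUltrametricDist K] {u w : K}
    (hu : ‖u‖ ≤ 1) (hw : ‖w‖ ≤ 1) (h : ‖u - w‖ < 1) (k : ℕ) : ‖u ^ k - w ^ k‖ < 1 := by
  induction k with
  | zero => simp
  | succ k ih =>
    rw [show u ^ (k + 1) - w ^ (k + 1) = u * (u ^ k - w ^ k) + (u - w) * w ^ k by ring]
    refine (IsUltrametricDist.norm_add_le_max _ _).trans_lt (max_lt ?_ ?_) <;> rw [norm_mul]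
    · exact mul_lt_one_of_nonneg_of_lt_one_right hu (norm_nonneg _) ih
    · refine mul_lt_one_of_nonneg_of_lt_one_left (norm_nonneg _) h ?_
      rw [norm_pow]
      exact pow_le_one₀ (norm_nonneg _) hw

theorem exists_isTeichmullerRep {u : ℂ_[p]} (hu : ‖u‖ = 1) : ∃ w, IsTeichmullerRep u w := by
  have hpp : p.Prime := Fact.out
  -- Some power of `u` is congruent to one.
  obtain ⟨k, hk0, hk⟩ : ∃ k, 0 < k ∧ ‖u ^ k - 1‖ < 1 := by
    obtain ⟨y, hy⟩ := (UniformSpace.Completion.denseRange_coe (α := PadicAlgCl p)).exists_dist_lt u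
      one_pos
    rw [dist_eq_norm] at hy
    have hy1 : ‖(y : ℂ_[p])‖ = 1 := by
      have h := norm_add_eq_right (s := (y : ℂ_[p]) - u) (t := u) (by rwa [norm_sub_rev, hu])
      rwa [sub_add_cancel, hu] at h
    obtain ⟨k, hk0, hk⟩ := exists_norm_pow_sub_one_lt_one_of_algebraic y
      ((PadicComplex.norm_extends p y).symm.trans hy1)
    refine ⟨k, hk0, ?_⟩
    rw [← PadicComplex.norm_extends] at hk
    have h1 : ((y ^ k - 1 : PadicAlgCl p) : ℂ_[p]) = (y : ℂ_[p]) ^ k - 1 := by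
      simp only [PadicComplex.coe_eq, map_sub, map_pow, map_one]
    rw [h1] at hk
    rw [← sub_add_sub_cancel _ ((y : ℂ_[p]) ^ k)]
    exact (IsUltrametricDist.norm_add_le_max _ _).trans_lt
      (max_lt (norm_pow_sub_pow_lt_one hu.le hy1.le hy k) hk)
  -- The exponent may be taken prime to `p`.
  obtain ⟨e, n, hn, rfl⟩ := Nat.exists_eq_pow_mul_and_not_dvd hk0.ne' p hpp.ne_one
  have hn0 : 0 < n := Nat.pos_of_mul_pos_left hk0
  rw [mul_comm, pow_mul] at hk
  have hun : ‖u ^ n - 1‖ < 1 := norm_sub_one_lt_one_of_pow_prime_pow hpp norm_natCast_prime_lt_one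
    (by rw [norm_pow, hu, one_pow]) hk
  -- Now `u ^ n - 1` is the product of the differences `u - ζ` with `ζ ^ n = 1`.
  have : NeZero n := ⟨hn0.ne'⟩
  obtain ⟨ξ, hξ⟩ := HasEnoughRootsOfUnity.exists_primitiveRoot ℂ_[p] n
  have hprod := congrArg (Polynomial.eval u) (Polynomial.X_pow_sub_one_eq_prod hn0 hξ)
  simp only [Polynomial.eval_sub, Polynomial.eval_pow, Polynomial.eval_X, Polynomial.eval_one,
    Polynomial.eval_prod, Polynomial.eval_C] at hprod
  rw [hprod, norm_prod] at hun
  obtain ⟨w, hw, hw1⟩ : ∃ w ∈ Polynomial.nthRootsFinset n (1 : ℂ_[p]), ‖u - w‖ < 1 := by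
    by_contra! h
    exact hun.not_ge (Finset.prod_induction _ (1 ≤ ·)
      (fun _ _ => one_le_mul_of_one_le_of_one_le) le_rfl h)
  exact ⟨w, ⟨n, hn0, ((Nat.Prime.coprime_iff_not_dvd hpp).mpr hn).symm,
    (Polynomial.mem_nthRootsFinset hn0 1).mp hw⟩, hw1⟩

/-- The Teichmüller character takes values in the fixed points of a power of the Frobenius map, and
`teichmuller u` lies in the residue class of `u`. -/
theorem teichmuller_spec {u : ℂ_[p]} (hu : ‖u‖ ≤ 1) :
    ‖u - teichmuller u‖ < 1 ∧ ∃ l, 0 < l ∧ teichmuller u ^ p ^ l = teichmuller u := by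
  have hpp : p.Prime := Fact.out
  by_cases h1 : ‖u‖ = 1
  · have h2 : IsTeichmullerRep u (teichmuller u) := by
      rw [teichmuller, if_pos h1]
      exact Classical.epsilon_spec (exists_isTeichmullerRep h1)
    obtain ⟨⟨n, hn0, hn, hw⟩, h3⟩ := h2
    refine ⟨h3, n.totient, Nat.totient_pos.mpr hn0, ?_⟩
    have := pow_eq_pow_of_modEq (Nat.ModEq.pow_totient hn.symm) hw
    rwa [pow_one] at this
  · have h2 : teichmuller u = 0 := if_neg h1
    refine ⟨by rw [h2, sub_zero]; exact lt_of_le_of_ne hu h1, 1, one_pos, ?_⟩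
    rw [h2, zero_pow (pow_pos hpp.pos 1).ne']

theorem pow_prime_pow_mul {w : ℂ_[p]} {l : ℕ} (h : w ^ p ^ l = w) (k : ℕ) :
    w ^ p ^ (l * k) = w := by
  induction k with
  | zero => simp
  | succ k ih => rw [Nat.mul_succ, pow_add, pow_mul, ih, h]

theorem one_sub_teichmuller_pow_ne_zero {u : ℂ_[p]} (hu : ‖u‖ ≤ 1) (hu1 : ‖1 - u‖ = 1) (α : ℕ) :
    1 - teichmuller u ^ p ^ α ≠ 0 := by
  intro h
  obtain ⟨h1, l, hl, h2⟩ := teichmuller_spec hu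
  have h3 : teichmuller u ^ p ^ (l * α) = 1 := by
    obtain ⟨n, hn⟩ := Nat.exists_eq_add_of_le (Nat.le_mul_of_pos_left α hl)
    rw [hn, pow_add, pow_mul, ← sub_eq_zero.mp h, one_pow]
  rw [pow_prime_pow_mul h2] at h3
  rw [h3, norm_sub_rev, hu1] at h1
  exact lt_irrefl _ h1

end Teichmuller

/-! ### Residues -/

section Residue

variable {p : ℕ} [Fact p.Prime]

theorem HasResidueAt.unique {f : ℂ_[p] → ℂ_[p]} {x₀ : ℂ_[p]} {r : ℝ} (hr : 0 < r) {c d : ℂ_[p]}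
    (hc : HasResidueAt f x₀ r c) (hd : HasResidueAt f x₀ r d) : c = d := by
  obtain ⟨ρ, hρ, u, rfl, hu⟩ := hc
  obtain ⟨σ, hσ, v, rfl, hv⟩ := hd
  obtain ⟨y, hy1, hy2⟩ := exists_norm_mem_Ioo (K := ℂ_[p]) hr (lt_min hρ hσ)
  have hadd : ∀ t : ℂ_[p], x₀ + t - x₀ = t := fun t => add_sub_cancel_left x₀ t
  have h := norm_coeff_mul_zpow_le (Fact.out : p.Prime).pos norm_natCast_prime_lt_one
    (u := fun n => u n - v n) (g := fun _ => 0) (y := y) (C := 0) (fun t ht => by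
      have h1 := hu (x₀ + t) (by rw [hadd, ht]; exact hy1.le)
        (by rw [hadd, ht]; exact hy2.trans_le (min_le_left _ _))
      have h2 := hv (x₀ + t) (by rw [hadd, ht]; exact hy1.le)
        (by rw [hadd, ht]; exact hy2.trans_le (min_le_right _ _))
      simpa only [hadd, sub_self, ← sub_mul] using h1.sub h2) (fun t _ => by simp) (-1)
  have h3 : 0 < ‖y‖ ^ (-1 : ℤ) := zpow_pos (hr.trans hy1) _
  exact sub_eq_zero.mp (norm_le_zero_iff.mp (nonpos_of_mul_nonpos_left h h3))

theorem residueAt_eq {f : ℂ_[p] → ℂ_[p]} {x₀ : ℂ_[p]} {r : ℝ} (hr : 0 < r) {c : ℂ_[p]}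
    (hc : HasResidueAt f x₀ r c) : residueAt f x₀ r = c :=
  HasResidueAt.unique hr (Classical.epsilon_spec ⟨c, hc⟩) hc

theorem discWithHoles_eq_holedDisc {M : ℕ} {a b : ℂ_[p]} {R : ℝ} (x : Fin M → ℂ_[p])
    (r : Fin M → ℝ) (hba : ‖b - a‖ = R) : discWithHoles a R x r = holedDisc b R x r := by
  have h : Metric.closedBall a R = Metric.closedBall b R :=
    IsUltrametricDist.closedBall_eq_of_mem (by rw [mem_closedBall_iff_norm, hba])
  ext z
  rw [discWithHoles, h]
  simp [holedDisc, dist_eq_norm]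

theorem arcSum_eq_rootMean (f : ℂ_[p] → ℂ_[p]) (a b : ℂ_[p]) (n : ℕ) :
    arcSum f a b n = rootMean (p ^ n) fun ζ => (b - a) * ζ * f (a + (b - a) * ζ) := by
  simp only [arcSum, rootMean, add_sub_cancel_left, Nat.cast_pow]

end Residue

end PadicLineIntegral

theorem mainTheorem1 (p : ℕ) [Fact p.Prime] (hp : p ≠ 2) (M : ℕ)
    (a b : ℂ_[p]) (R : ℝ) (hR : 0 < R) (x : Fin M → ℂ_[p]) (r : Fin M → ℝ)
    (hr : ∀ i, 0 < r i) (hrR : ∀ i, r i < R)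
    (hdisj : ∀ i j, i ≠ j →
      Disjoint (Metric.closedBall (x i) (r i)) (Metric.closedBall (x j) (r j)))
    (hba : ‖b - a‖ = R) (hbx : ∀ i, ‖b - x i‖ = R) (α : ℕ)
    (f : ℂ_[p] → ℂ_[p])
    (hf : PadicLineIntegral.IsKrasnerAnalyticOn f (PadicLineIntegral.discWithHoles a R x r)) :
    (∀ i, ∃! c, PadicLineIntegral.HasResidueAt f (x i) (r i) c) ∧
    (∀ i, 1 - PadicLineIntegral.teichmuller ((a - x i) / (a - b)) ^ (p ^ α) ≠ 0) ∧
    PadicLineIntegral.HasArcIntegral f a b (PadicLineIntegral.Phi α)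
      (∑ i, 1 / (1 - PadicLineIntegral.teichmuller ((a - x i) / (a - b)) ^ (p ^ α)) *
        PadicLineIntegral.residueAt f (x i) (r i)) := by
  open PadicLineIntegral Filter Topology in
  have hpp : p.Prime := Fact.out
  have hp1 : ‖((p : ℕ) : ℂ_[p])‖ < 1 := norm_natCast_prime_lt_one
  have hsep : ∀ i j, i ≠ j → r i < ‖x j - x i‖ := by
    intro i j hij
    have h := Set.disjoint_right.mp (hdisj i j hij) (Metric.mem_closedBall_self (hr j).le)
    rwa [mem_closedBall_iff_norm, not_le] at h
  have hxb : ∀ i, ‖x i - b‖ = R := fun i => by rw [norm_sub_rev, hbx]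
  obtain ⟨c, hc⟩ : ∃ c, IsMittagLeffler b R x r (fun z => f z) c := by
    obtain ⟨P, Q, hQ, hlim⟩ := hf
    rw [discWithHoles_eq_holedDisc x r hba] at hQ hlim
    refine exists_isMittagLeffler_of_tendstoUniformly hpp.pos hp1 hR hr hrR hxb hsep
      (F := fun k z => (P k).eval (z : ℂ_[p]) / (Q k).eval (z : ℂ_[p]))
      (fun k => exists_isMittagLeffler_eval_div_eval hR hr (P k) (hQ k)) fun ε hε => ?_
    obtain ⟨k₀, hk₀⟩ := eventually_atTop.mp (Metric.tendstoUniformlyOn_iff.mp hlim ε hε)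
    refine ⟨k₀, fun k hk z => ?_⟩
    have := hk₀ k hk z z.2
    rw [dist_comm, dist_eq_norm] at this
    exact this.le
  have hres : ∀ i, HasResidueAt f (x i) (r i) (c (Sum.inr (i, 0))) := by
    intro i
    obtain ⟨ρ, hrρ, hρR, hρ⟩ := exists_annulus hrR hsep i
    obtain ⟨u, hu1, hu2⟩ := hc.exists_laurent hr (fun i => (hxb i).le) hsep hρR hρ
    refine ⟨ρ, hrρ, u, by simpa using hu1 0, fun z hz hzρ => ?_⟩
    simpa only [add_sub_cancel] using hu2 (z - x i) hz hzρ
  have hba0 : a - b ≠ 0 := by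
    rw [← norm_pos_iff, norm_sub_rev, hba]
    exact hR
  have hu1 : ∀ i, ‖1 - (a - x i) / (a - b)‖ = 1 := fun i => by
    rw [one_sub_div hba0, sub_sub_sub_cancel_left, norm_div, hxb, norm_sub_rev a b, hba,
      div_self hR.ne']
  have hu : ∀ i, ‖(a - x i) / (a - b)‖ ≤ 1 := fun i => by
    rw [← sub_sub_cancel 1 ((a - x i) / (a - b))]
    exact (norm_sub_le_max _ _).trans (max_le norm_one.le (hu1 i).le)
  have hne := fun i => one_sub_teichmuller_pow_ne_zero (hu i) (hu1 i) α
  refine ⟨fun i => ⟨_, hres i, fun d hd => hd.unique (hr i) (hres i)⟩, hne, fun ε hε => ?_⟩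
  simp only [fun i => residueAt_eq (hr i) (hres i)]
  choose hω l hl hlω using fun i => teichmuller_spec (hu i)
  -- A common period of the Frobenius map on the values of the Teichmüller character.
  have hL : 0 < ∏ i, l i := Finset.prod_pos fun i _ => hl i
  have hφ : Tendsto (fun k => α + (∏ i, l i) * k) atTop atTop :=
    tendsto_atTop_mono (fun k => (Nat.le_mul_of_pos_left k hL).trans (Nat.le_add_left _ _))
      tendsto_id
  have hv : ∀ i, Tendsto (fun k => ((a - x i) / (a - b)) ^ p ^ (α + (∏ i, l i) * k)) atTop
      (𝓝 (teichmuller ((a - x i) / (a - b)) ^ p ^ α)) := by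
    intro i
    have h1 := ((tendsto_pow_prime_pow_sub hpp hp1 (hu i) (hω i)).comp hφ).add_const
      (teichmuller ((a - x i) / (a - b)) ^ p ^ α)
    rw [zero_add] at h1
    refine h1.congr fun k => ?_
    obtain ⟨m, hm⟩ := Finset.dvd_prod_of_mem l (Finset.mem_univ i)
    have h2 : teichmuller ((a - x i) / (a - b)) ^ p ^ (α + (∏ i, l i) * k) =
        teichmuller ((a - x i) / (a - b)) ^ p ^ α := by
      rw [hm, mul_assoc, add_comm, pow_add, pow_mul, pow_prime_pow_mul (hlω i)]
    rw [Function.comp_apply, h2, sub_add_cancel]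
  have hlim := hc.tendsto_rootMean hpp hp1 hR hr hrR hba hbx hφ hv hne
  obtain ⟨k₀, hk₀⟩ := Metric.tendsto_atTop.mp hlim ε hε
  refine ⟨_, ⟨∏ i, l i, hL, rfl⟩, k₀, fun k hk => ?_⟩
  rw [arcSum_eq_rootMean, ← dist_eq_norm]
  exact hk₀ k hk.le
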